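/- Let $a,b,c,d\ge 0$ be integers with $S:=a+b=c+d$ and $bc\neq 0$, put $m:=a-c=d-b$ and $\sigma:=m/S$, and assume $\sigma>\tfrac12$ (so $\tfrac S2<m<S$). Consider the two-colour P\'olya urn in discrete time: at each step a ball is drawn uniformly at random from the urn and put back; if it is red, $a$ red and $b$ black balls are added, and if it is black, $c$ red and $d$ black balls are added. Let $U_{(\alpha,\beta)}(n)\in\mathbb N^2$ be the composition (red, black) of the urn after $n$ draws when it starts with $\alpha$ red and $\beta$ black balls, and let $u_2(x,y)=\frac1S(bx-cy)$. Then the limits $$X=W^{DT}_{(1,0)}:=\lim_{n\to\infty}\frac{u_2\big(U_{(1,0)}(n)\big)}{n^{\sigma}},\qquad Y=W^{DT}_{(0,1)}:=\lim_{n\to\infty}\frac{u_2\big(U_{(0,1)}(n)\big)}{n^{\sigma}}$$ exist almost surely and, writing $\varphi_X(t)=\mathbb E(e^{itX})$ and $\varphi_Y(t)=\mathbb E(e^{itY})$: (i) the supports of (the laws of) $X$ and $Y$ are both equal to $\mathbb R$; (ii) for every $\rho\in\left]0,\frac{a+1}{m}\right[$ there is $C>0$ such that $|\varphi_X(t)|\le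 C|t|^{-\rho}$ for all $t\in\mathbb R\setminus\{0\}$; (iii) for every $\rho\in\left]0,\frac{d+1}{m}\right[$ there is $C>0$ such that $|\varphi_Y(t)|\le C|t|^{-\rho}$ for all $t\in\mathbb R\setminus\{0\}$; (iv) the laws of $X$ and $Y$ are absolutely continuous with respect to Lebesgue measure, with densities that are bounded and continuous on $\mathbb R$. -/

import Mathlib

open MeasureTheory ProbabilityTheory Filter Topology

namespace PolyaUrn

/-- One-step transition probability of the two-colour urn with replacement matrix
`(a, b; c, d)`: from the composition `x = (red, black)`, a ball is drawn uniformly among the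
`x.1 + x.2` balls of the urn; if it is red, `a` red and `b` black balls are added, and if it is
black, `c` red and `d` black balls are added. -/
noncomputable def stepProb (a b c d : ℕ) (x y : ℕ × ℕ) : ENNReal :=
  (if y = (x.1 + a, x.2 + b) then (x.1 : ENNReal) / ((x.1 + x.2 : ℕ) : ENNReal) else 0) +
  (if y = (x.1 + c, x.2 + d) then (x.2 : ENNReal) / ((x.1 + x.2 : ℕ) : ENNReal) else 0)

/-- `U` is a discrete-time two-colour Pólya urn process with replacement matrix `(a, b; c, d)`,
started from the composition `init`, on the probability space `(Ω, P)`: it is the Markov chain on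
`ℕ × ℕ` started at `init` with transition probabilities `stepProb a b c d`. -/
structure IsUrnProcess (a b c d : ℕ) (init : ℕ × ℕ) {Ω : Type*} [MeasurableSpace Ω]
    (P : Measure Ω) (U : ℕ → Ω → ℕ × ℕ) : Prop where
  measurable : ∀ n, Measurable (U n)
  start : ∀ᵐ ω ∂P, U 0 ω = init
  step : ∀ (n : ℕ) (x : ℕ → ℕ × ℕ),
    P {ω | ∀ i ≤ n + 1, U i ω = x i} =
      P {ω | ∀ i ≤ n, U i ω = x i} * stepProb a b c d (x n) (x (n + 1))

/-- The eigenvalue `m = a - c` (it equals `d - b` when `a + b = c + d`). -/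
def eigm (a c : ℕ) : ℝ := (a : ℝ) - (c : ℝ)

/-- The ratio `σ = m / S` of the eigenvalues, with `S = a + b`. -/
noncomputable def sigma (a b c : ℕ) : ℝ := eigm a c / ((a : ℝ) + (b : ℝ))

/-- The eigenform `u₂(x, y) = (b x - c y) / S` of the transposed replacement matrix. -/
noncomputable def u₂ (a b c : ℕ) (x : ℕ × ℕ) : ℝ :=
  ((b : ℝ) * (x.1 : ℝ) - (c : ℝ) * (x.2 : ℝ)) / ((a : ℝ) + (b : ℝ))

/-- The normalised second projection `u₂(U(n)) / n ^ σ` of the urn process. -/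
noncomputable def normProj (a b c : ℕ) {Ω : Type*} (U : ℕ → Ω → ℕ × ℕ) (n : ℕ) (ω : Ω) : ℝ :=
  u₂ a b c (U n ω) / (n : ℝ) ^ sigma a b c

/-- The limit random variable `W = lim u₂(U(n)) / n ^ σ` of the urn process (an arbitrary value is
taken where the limit does not exist). -/
noncomputable def W (a b c : ℕ) {Ω : Type*} (U : ℕ → Ω → ℕ × ℕ) (ω : Ω) : ℝ :=
  limUnder atTop (fun n : ℕ => normProj a b c U n ω)

/-- The real probability measure `ν` is absolutely continuous with respect to Lebesgue measure,
with a bounded continuous density. -/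
def HasBoundedContinuousDensity (ν : Measure ℝ) : Prop :=
  ν ≪ volume ∧
    ∃ f : ℝ → ℝ, Continuous f ∧ (∀ x, 0 ≤ f x) ∧ (∃ M : ℝ, ∀ x, f x ≤ M) ∧
      ν = volume.withDensity (fun x => ENNReal.ofReal (f x))

section Existence

open Finset

/-- The one-step transition law of the urn as a measure (the empty urn stays empty). -/
noncomputable def stepMeasure (a b c d : ℕ) (x : ℕ × ℕ) : Measure (ℕ × ℕ) :=
  if x.1 + x.2 = 0 then Measure.dirac x else
    ((x.1 : ENNReal) / ((x.1 + x.2 : ℕ) : ENNReal)) • Measure.dirac (x.1 + a, x.2 + b) +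
    ((x.2 : ENNReal) / ((x.1 + x.2 : ℕ) : ENNReal)) • Measure.dirac (x.1 + c, x.2 + d)

instance isProbabilityMeasure_stepMeasure (a b c d : ℕ) (x : ℕ × ℕ) : IsProbabilityMeasure (stepMeasure a b c d x) := by
  unfold stepMeasure
  split_ifs with h
  · infer_instance
  · constructor
    simp only [Measure.add_apply, Measure.smul_apply, measure_univ, smul_eq_mul, mul_one]
    rw [← ENNReal.add_div, ← Nat.cast_add]
    exact ENNReal.div_self (by exact_mod_cast h) (ENNReal.natCast_ne_top _)

/-- Urn processes exist: for every nonempty initial composition there is one on path space. -/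
theorem exists_isUrnProcess (a b c d : ℕ) (init : ℕ × ℕ) (h : init ≠ (0, 0)) :
    ∃ P : Measure (ℕ → ℕ × ℕ), IsProbabilityMeasure P ∧
      IsUrnProcess a b c d init P (fun n ω => ω n) := by
  let κ : (n : ℕ) → Kernel (Π _ : Iic n, ℕ × ℕ) (ℕ × ℕ) := fun n =>
    Kernel.comap ⟨stepMeasure a b c d, measurable_of_countable _⟩
      (fun y : (Π _ : Iic n, ℕ × ℕ) => y ⟨n, by simp⟩) (by fun_prop)
  have hκ : ∀ n, IsMarkovKernel (κ n) := fun n =>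
    ⟨fun y => inferInstanceAs (IsProbabilityMeasure (stepMeasure a b c d _))⟩
  let P : Measure (ℕ → ℕ × ℕ) := Kernel.traj (X := fun _ => ℕ × ℕ) κ 0 (fun _ => init)
  have key (n : ℕ) (x : ℕ → ℕ × ℕ) : P {ω | ∀ i ≤ n + 1, ω i = x i} =
      P {ω | ∀ i ≤ n, ω i = x i} * stepMeasure a b c d (x n) {x (n + 1)} := by
    have e := Kernel.partialTraj_compProd_eq_map_traj
      (X := fun _ => ℕ × ℕ) (κ := κ) (Nat.zero_le n) (x₀ := fun _ => init)
    rw [← Kernel.traj_map_frestrictLe_apply] at e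
    let r : Π _ : Iic n, ℕ × ℕ := fun i => x i
    have e2 := congrArg (fun ν => ν ({r} ×ˢ {x (n + 1)})) e
    rw [Measure.compProd_apply_prod (.singleton _) (.singleton _), lintegral_singleton,
      Measure.map_apply (by fun_prop) ((MeasurableSet.singleton _).prod (.singleton _)),
      Measure.map_apply (by fun_prop) (.singleton _)] at e2
    have s1 : {ω : ℕ → ℕ × ℕ | ∀ i ≤ n + 1, ω i = x i} =
        (fun x ↦ (Preorder.frestrictLe (π := fun _ => ℕ × ℕ) n x, x (n + 1))) ⁻¹'
          ({r} ×ˢ {x (n + 1)}) := by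
      ext ω
      simp only [Set.mem_ofPred_eq, Set.mem_preimage, Set.mem_prod, Set.mem_singleton_iff,
        funext_iff, Subtype.forall, mem_Iic]
      constructor
      · exact fun h => ⟨fun i hi => h i (by omega), h _ le_rfl⟩
      · rintro ⟨h1, h2⟩ i hi
        rcases Nat.lt_or_ge n i with h | h
        · obtain rfl : i = n + 1 := by omega
          exact h2
        · exact h1 i h
    have s2 : {ω : ℕ → ℕ × ℕ | ∀ i ≤ n, ω i = x i} =
        (Preorder.frestrictLe (π := fun _ => ℕ × ℕ) n) ⁻¹' {r} := by
      ext ω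
      simp only [Set.mem_ofPred_eq, Set.mem_preimage, Set.mem_singleton_iff,
        funext_iff, Subtype.forall, mem_Iic]
      rfl
    rw [s1, s2, ← e2, mul_comm]
    rfl
  have h0 : ∀ᵐ ω ∂P, ω 0 = init := by
    have hm : P.map (Preorder.frestrictLe (π := fun _ => ℕ × ℕ) 0) =
        Measure.dirac (fun _ => init) := by
      rw [Kernel.traj_map_frestrictLe_apply, Kernel.partialTraj_self, Kernel.id_apply]
    have h1 : ∀ᵐ y ∂(P.map (Preorder.frestrictLe (π := fun _ => ℕ × ℕ) 0)),
        y ⟨0, by simp⟩ = init := by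
      rw [hm]
      have hs : MeasurableSet {y : (Π _ : Iic 0, ℕ × ℕ) | y ⟨0, by simp⟩ = init} :=
        (Set.to_countable _).measurableSet
      exact (ae_dirac_iff hs).2 rfl
    exact ae_of_ae_map (by fun_prop) h1
  have hpos : ∀ n (x : ℕ → ℕ × ℕ), (x n).1 + (x n).2 = 0 → P {ω | ∀ i ≤ n, ω i = x i} = 0 := by
    intro n
    induction n with
    | zero =>
      intro x hx
      refine measure_mono_null (t := {ω | ¬ ω 0 = init}) (fun ω hω => ?_) (ae_iff.1 h0)
      have e : ω 0 = x 0 := hω 0 le_rfl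
      intro (e' : ω 0 = init)
      refine h ?_
      rw [← e', e]
      ext
      · show (x 0).1 = 0
        omega
      · show (x 0).2 = 0
        omega
    | succ n ih =>
      intro x hx
      rw [key]
      by_cases hn : (x n).1 + (x n).2 = 0
      · rw [ih x hn, zero_mul]
      · have h1 : ((x n).1 + a, (x n).2 + b) ≠ x (n + 1) := fun e => by
          rw [← e] at hx; simp only at hx; omega
        have h2 : ((x n).1 + c, (x n).2 + d) ≠ x (n + 1) := fun e => by
          rw [← e] at hx; simp only at hx; omega
        rw [stepMeasure, if_neg hn]
        simp [h1, h2]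
  refine ⟨P, inferInstance, fun n => by fun_prop, h0, fun n x => ?_⟩
  rw [key]
  by_cases hx : (x n).1 + (x n).2 = 0
  · rw [hpos n x hx]; simp
  · congr 1
    unfold stepMeasure stepProb
    rw [if_neg hx]
    simp [Set.indicator_apply, eq_comm]

end Existence

end PolyaUrn

/-!
The growth of the mean of `u₂(U(n))` is the factor that turns it into a martingale bounded in `L²`,
as `σ > 1/2`; this gives the almost sure limit and its mean, `u₂` of the initial composition up to a
positive factor. The law `μ x` of the limit for the urn started from `x` depends on `x` only.

Each ball carries its own descendants, so an urn started from `x + y` splits into two urns started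
from `x` and `y`, and the proportion of draws that concern the first converges to a beta variable.
Hence `μ (x + y)` is the law of `V ^ σ X + (1 - V) ^ σ Y` with `X`, `Y`, `V` independent of laws
`μ x`, `μ y` and beta, while `μ x` is a mixture of `μ (x + (a, b))` and `μ (x + (c, d))` by the
first draw. Everything follows from these two identities.

* For fixed `(p, q) ≠ 0` the map `v ↦ v ^ σ p + (1 - v) ^ σ q` has at most one critical point, so it
  pulls null sets back to null sets; there is no atom at `0`, and `μ x` is absolutely continuous.
* By the Riemann–Lebesgue lemma the characteristic function `φ` of `μ x` vanishes at infinity, so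
  `φ(t) ≤ E[|φ(V ^ σ t)| h((1 - V) ^ σ t)]` with `h → 0` is an asymptotic contraction for the weight
  `|t| ^ ρ`. This bounds `|t| ^ ρ φ(t)` when `σ ρ` is less than the number of balls of `x` divided
  by `a + b`, and further draws lift any bound on `ρ`. Fourier inversion gives the density.
* The support of the law contains positive and negative points, since `μ (1, 0)` and `μ (0, 1)` have
  means of opposite signs, and is stable under `(p, q) ↦ v ^ σ p + (1 - v) ^ σ q` for `v ∈ [0, 1]`.
  It is connected, and unbounded because `v = 1/2` scales by `2 ^ (1 - σ) > 1`.
-/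

namespace PolyaUrn

/-! ### The urn as a Markov chain -/

/-- The number of balls of a composition. -/
def total (x : ℕ × ℕ) : ℕ := x.1 + x.2

@[simp] lemma total_add (x y : ℕ × ℕ) : total (x + y) = total x + total y := by
  simp only [total, Prod.fst_add, Prod.snd_add]; ring

lemma total_pos_iff {x : ℕ × ℕ} : 0 < total x ↔ x ≠ 0 := by
  simp only [total, ne_eq, Prod.ext_iff, Prod.fst_zero, Prod.snd_zero]; omega

lemma fst_div_total_add_snd_div_total {x : ℕ × ℕ} (hx : x ≠ 0) :
    (x.1 : ℝ) / total x + x.2 / total x = 1 := by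
  have hpos : (0 : ℝ) < total x := by exact_mod_cast total_pos_iff.2 hx
  rw [← add_div, ← Nat.cast_add]
  exact div_self hpos.ne'

lemma add_ne_zero_of_left {x : ℕ × ℕ} (hx : x ≠ 0) (y : ℕ × ℕ) : x + y ≠ 0 := by
  rw [← total_pos_iff] at hx ⊢
  rw [total_add]
  omega

lemma stepMeasure_eq (a b c d : ℕ) {x : ℕ × ℕ} (hx : x ≠ 0) :
    stepMeasure a b c d x =
      ((x.1 : ENNReal) / (total x : ENNReal)) • Measure.dirac (x + (a, b)) +
      ((x.2 : ENNReal) / (total x : ENNReal)) • Measure.dirac (x + (c, d)) :=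
  if_neg (total_pos_iff.2 hx).ne'

lemma stepMeasure_singleton (a b c d : ℕ) {x : ℕ × ℕ} (hx : x ≠ 0) (y : ℕ × ℕ) :
    stepMeasure a b c d x {y} = stepProb a b c d x y := by
  rw [stepMeasure_eq a b c d hx]
  simp [stepProb, total, Set.indicator_apply, eq_comm, Prod.add_def]

section Transition

variable {E : Type*} [NormedAddCommGroup E]

lemma stronglyMeasurable_of_composition (g : ℕ × ℕ → E) : StronglyMeasurable g := by
  borelize E
  exact stronglyMeasurable_iff_measurable_separable.2
    ⟨measurable_of_countable _, (Set.countable_range g).isSeparable⟩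

variable [NormedSpace ℝ E]

/-- The transition operator of the urn: `transition a b c d g x` is the mean of `g` after one draw
from the composition `x`. -/
noncomputable def transition (a b c d : ℕ) (g : ℕ × ℕ → E) (x : ℕ × ℕ) : E :=
  ∫ y, g y ∂stepMeasure a b c d x

lemma transition_apply [CompleteSpace E] (a b c d : ℕ) (g : ℕ × ℕ → E) {x : ℕ × ℕ}
    (hx : x ≠ 0) : transition a b c d g x =
      ((x.1 : ℝ) / total x) • g (x + (a, b)) + ((x.2 : ℝ) / total x) • g (x + (c, d)) := by
  have hfin (k : ℕ) : (k : ENNReal) / (total x : ENNReal) ≠ ⊤ :=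
    ENNReal.div_ne_top (by simp) (by exact_mod_cast (total_pos_iff.2 hx).ne')
  have hgint (k : ℕ) (y : ℕ × ℕ) :
      Integrable g (((k : ENNReal) / (total x : ENNReal)) • Measure.dirac y) :=
    (integrable_dirac (by simp)).smul_measure (hfin k)
  rw [transition, stepMeasure_eq a b c d hx, integral_add_measure (hgint _ _) (hgint _ _)]
  simp only [integral_smul_measure, integral_dirac, ENNReal.toReal_div, ENNReal.toReal_natCast]

lemma norm_transition_le (a b c d : ℕ) {g : ℕ × ℕ → E} {C : ℝ} (hg : ∀ x, ‖g x‖ ≤ C)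
    (x : ℕ × ℕ) : ‖transition a b c d g x‖ ≤ C := by
  simpa [transition] using
    norm_integral_le_of_norm_le_const (μ := stepMeasure a b c d x) (ae_of_all _ hg)

end Transition

/-- The transition law of the urn as a Markov kernel on compositions. -/
noncomputable def stepKernel (a b c d : ℕ) : Kernel (ℕ × ℕ) (ℕ × ℕ) :=
  ⟨stepMeasure a b c d, measurable_of_countable _⟩

instance (a b c d : ℕ) : IsMarkovKernel (stepKernel a b c d) :=
  ⟨isProbabilityMeasure_stepMeasure a b c d⟩

section MarkovChain

variable {Ω : Type*} {U : ℕ → Ω → ℕ × ℕ}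

/-- The history of a process up to time `n`. -/
def history (U : ℕ → Ω → ℕ × ℕ) (n : ℕ) (ω : Ω) : Set.Iic n → ℕ × ℕ :=
  (Set.Iic n).domRestrict fun i => U i ω

lemma history_eq_domRestrict_iff {n : ℕ} {ω : Ω} {x : ℕ → ℕ × ℕ} :
    history U n ω = (Set.Iic n).domRestrict x ↔ ∀ i ≤ n, U i ω = x i := by
  simp only [history, funext_iff, Set.domRestrict_apply, Subtype.forall, Set.mem_Iic]

variable {a b c d : ℕ} {init : ℕ × ℕ} [MeasurableSpace Ω] {P : Measure Ω}

namespace IsUrnProcess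

lemma measurable_history (hU : IsUrnProcess a b c d init P U) (n : ℕ) :
    Measurable (history U n) :=
  measurable_pi_lambda _ fun i => hU.measurable i

lemma cylinder_eq_zero (hU : IsUrnProcess a b c d init P U) (h : init ≠ 0) (n : ℕ)
    (x : ℕ → ℕ × ℕ) (hx : x n = 0) : P {ω | ∀ i ≤ n, U i ω = x i} = 0 := by
  induction n generalizing x with
  | zero =>
    refine measure_mono_null (fun ω hω (hstart : U 0 ω = init) => h ?_) (ae_iff.1 hU.start)
    rw [← hstart, ← hx]
    exact hω 0 le_rfl
  | succ n ih =>
    rw [hU.step]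
    by_cases hn : x n = 0
    · rw [ih x hn, zero_mul]
    · rw [hx, ← stepMeasure_singleton a b c d hn, stepMeasure_eq a b c d hn]
      simp [add_ne_zero_of_left hn]

lemma hasCondDistrib [SFinite P] (hU : IsUrnProcess a b c d init P U) (h : init ≠ 0) (n : ℕ) :
    HasCondDistrib (U (n + 1)) (history U n) ((stepKernel a b c d).comap
      (fun z => z ⟨n, Set.self_mem_Iic⟩) (measurable_pi_apply _)) P := by
  have hmeas := (hU.measurable_history n).prodMk (hU.measurable (n + 1))
  refine ⟨hmeas.aemeasurable, Measure.ext_of_singleton fun ⟨z, y⟩ => ?_⟩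
  obtain ⟨x, rfl, rfl⟩ : ∃ x : ℕ → ℕ × ℕ, (Set.Iic n).domRestrict x = z ∧ x (n + 1) = y :=
    ⟨fun i => if hi : i ≤ n then z ⟨i, hi⟩ else y,
      funext fun i => dif_pos (Set.mem_Iic.1 i.2), dif_neg (by omega)⟩
  have hcylinder : history U n ⁻¹' {(Set.Iic n).domRestrict x} = {ω | ∀ i ≤ n, U i ω = x i} :=
    Set.ext fun ω => history_eq_domRestrict_iff
  have hcylinder_succ : (fun ω => (history U n ω, U (n + 1) ω)) ⁻¹'
      {((Set.Iic n).domRestrict x, x (n + 1))} = {ω | ∀ i ≤ n + 1, U i ω = x i} := by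
    ext ω
    simp only [Set.mem_preimage, Set.mem_singleton_iff, Prod.mk_inj, history_eq_domRestrict_iff,
      Set.mem_ofPred_eq, Nat.le_succ_iff, or_imp, forall_and, forall_eq]
  rw [Measure.map_apply hmeas (.singleton _), hcylinder_succ, ← Set.singleton_prod_singleton,
    Measure.compProd_apply_prod (.singleton _) (.singleton _), lintegral_singleton,
    Measure.map_apply (hU.measurable_history n) (.singleton _), hcylinder, hU.step, mul_comm]
  by_cases hx : x n = 0
  · simp only [hU.cylinder_eq_zero h n x hx, mul_zero]
  · exact congrArg (· * _) (stepMeasure_singleton a b c d hx _).symm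

/-- The filtration generated by an urn process. -/
def filtration (hU : IsUrnProcess a b c d init P U) :
    Filtration ℕ (inferInstance : MeasurableSpace Ω) :=
  Filtration.natural U fun n => (hU.measurable n).stronglyMeasurable

lemma measurable_filtration (hU : IsUrnProcess a b c d init P U) (n : ℕ) :
    Measurable[hU.filtration n] (U n) :=
  (Filtration.stronglyAdapted_natural fun n => (hU.measurable n).stronglyMeasurable) n |>.measurable

lemma aestronglyMeasurable_comp {E : Type*} [NormedAddCommGroup E]
    (hU : IsUrnProcess a b c d init P U) (g : ℕ × ℕ → E) (n : ℕ) :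
    AEStronglyMeasurable (fun ω => g (U n ω)) P :=
  ((stronglyMeasurable_of_composition g).comp_measurable (hU.measurable n)).aestronglyMeasurable

variable [IsProbabilityMeasure P]

lemma ae_total (hU : IsUrnProcess a b c d init P U) (h : init ≠ 0) (hbal : a + b = c + d) (n : ℕ) :
    ∀ᵐ ω ∂P, total (U n ω) = total init + n * (a + b) := by
  induction n with
  | zero => exact hU.start.mono fun ω hω => by rw [hω, zero_mul, add_zero]
  | succ n ih =>
    have hstep : ∀ᵐ z ∂P.map (history U n), ∀ᵐ y ∂stepMeasure a b c d (z ⟨n, Set.self_mem_Iic⟩),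
        total y = total init + (n + 1) * (a + b) := by
      refine (ae_map_iff (hU.measurable_history n).aemeasurable
        (Set.to_countable _).measurableSet).2 (ih.mono fun ω hω => ?_)
      change total (history U n ω ⟨n, Set.self_mem_Iic⟩) = _ at hω
      have hne : history U n ω ⟨n, Set.self_mem_Iic⟩ ≠ 0 := by
        rw [← total_pos_iff] at h ⊢
        omega
      rw [stepMeasure_eq a b c d hne, ae_add_measure_iff]
      constructor <;> refine Measure.ae_smul_measure ?_ _ <;>
        simp only [ae_dirac_eq, eventually_pure, total_add, hω] <;> simp only [total] <;> linarith
    have hjoint := Measure.ae_compProd_of_ae_ae (κ := (stepKernel a b c d).comap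
        (fun z : Set.Iic n → ℕ × ℕ => z ⟨n, Set.self_mem_Iic⟩) (measurable_pi_apply _))
      (p := fun q => total q.2 = total init + (n + 1) * (a + b))
      (Set.to_countable _).measurableSet hstep
    rw [← (hU.hasCondDistrib h n).map_eq] at hjoint
    exact ae_of_ae_map (hU.hasCondDistrib h n).aemeasurable hjoint

section Mean

variable {E : Type*} [NormedAddCommGroup E] [NormedSpace ℝ E] [CompleteSpace E]

lemma condExp_comp_succ (hU : IsUrnProcess a b c d init P U) (h : init ≠ 0) (n : ℕ)
    (g : ℕ × ℕ → E) (hgint : Integrable (fun ω => g (U (n + 1) ω)) P) :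
    P[fun ω => g (U (n + 1) ω) | hU.filtration n] =ᵐ[P]
      fun ω => transition a b c d g (U n ω) := by
  rw [filtration, Filtration.natural_eq_comap]
  refine (condExp_ae_eq_integral_condDistrib (hU.measurable_history n)
    (hU.measurable (n + 1)).aemeasurable (stronglyMeasurable_of_composition g) hgint).trans ?_
  have hker := condDistrib_ae_eq_of_measure_eq_compProd (history U n)
    (hU.measurable (n + 1)).aemeasurable (hU.hasCondDistrib h n).map_eq
  filter_upwards [ae_of_ae_map (hU.measurable_history n).aemeasurable hker] with ω hω
  rw [hω]
  rfl

lemma integral_comp_succ (hU : IsUrnProcess a b c d init P U) (h : init ≠ 0) (n : ℕ)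
    (g : ℕ × ℕ → E) (hgint : Integrable (fun ω => g (U (n + 1) ω)) P) :
    ∫ ω, g (U (n + 1) ω) ∂P = ∫ ω, transition a b c d g (U n ω) ∂P := by
  rw [← integral_condExp (hU.filtration.le n), integral_congr_ae (hU.condExp_comp_succ h n g hgint)]

lemma integral_comp_eq_iterate (hU : IsUrnProcess a b c d init P U) (h : init ≠ 0) (n : ℕ)
    {g : ℕ × ℕ → E} {C : ℝ} (hC : ∀ x, ‖g x‖ ≤ C) :
    ∫ ω, g (U n ω) ∂P = (transition a b c d)^[n] g init := by
  induction n generalizing g with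
  | zero =>
    rw [integral_congr_ae (hU.start.mono fun ω hω => congrArg g hω), integral_const]
    simp
  | succ n ih =>
    rw [hU.integral_comp_succ h n g (.of_bound (hU.aestronglyMeasurable_comp g _) C
      (ae_of_all _ fun _ => hC _)), Function.iterate_succ_apply]
    exact ih (norm_transition_le a b c d hC)

end Mean

end IsUrnProcess

end MarkovChain

/-! ### The martingale of the second projection -/

lemma uniformIntegrable_of_integral_sq_le {Ω ι : Type*} [MeasurableSpace Ω] {P : Measure Ω}
    [IsFiniteMeasure P] {f : ι → Ω → ℝ} (hf : ∀ i, MemLp (f i) 2 P) {R : ℝ}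
    (hR : ∀ i, ∫ ω, f i ω ^ 2 ∂P ≤ R) : UniformIntegrable f 1 P := by
  refine uniformIntegrable_of le_rfl ENNReal.one_ne_top (fun i => (hf i).1) fun ε hε => ?_
  obtain ⟨C, hC, hRC⟩ : ∃ C : NNReal, 0 < C ∧ R / ε ≤ C :=
    ⟨max (R / ε).toNNReal 1, by positivity, (Real.le_coe_toNNReal _).trans (by simp)⟩
  refine ⟨C, fun i => ?_⟩
  have hle (ω : Ω) : ‖{x | C ≤ ‖f i x‖₊}.indicator (f i) ω‖ₑ ≤ ENNReal.ofReal (f i ω ^ 2 / C) := by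
    by_cases hω : ω ∈ {x | C ≤ ‖f i x‖₊}
    · have hCf : (C : ℝ) ≤ |f i ω| := hω
      rw [Set.indicator_of_mem hω, Real.enorm_eq_ofReal_abs]
      refine ENNReal.ofReal_le_ofReal ?_
      rw [le_div_iff₀ (by exact_mod_cast hC), ← sq_abs, sq]
      exact mul_le_mul_of_nonneg_left hCf (abs_nonneg _)
    · rw [Set.indicator_of_notMem hω, enorm_zero]
      exact zero_le
  rw [eLpNorm_one_eq_lintegral_enorm]
  refine (lintegral_mono hle).trans ?_
  rw [← ofReal_integral_eq_lintegral_ofReal ((hf i).integrable_sq.div_const _)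
    (ae_of_all _ fun ω => by positivity), integral_div]
  refine ENNReal.ofReal_le_ofReal ?_
  rw [div_le_iff₀ (by exact_mod_cast hC), ← div_le_iff₀' hε]
  exact (div_le_div_of_nonneg_right (hR i) hε.le).trans hRC

/-- The factor by which the mean of the second projection grows in `n` draws, in terms of the
ratio `σ` and of the shape `τ` of the initial composition. -/
noncomputable def growth (σ τ : ℝ) (n : ℕ) : ℝ := ∏ i ∈ Finset.range n, (1 + σ / (τ + i))

section Growth

variable {σ τ : ℝ}

lemma growth_succ (n : ℕ) : growth σ τ (n + 1) = growth σ τ n * (1 + σ / (τ + n)) :=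
  Finset.prod_range_succ _ _

lemma growth_pos (hσ : 0 < σ) (hτ : 0 < τ) (n : ℕ) : 0 < growth σ τ n :=
  Finset.prod_pos fun i _ => by positivity

lemma growth_succ_eq_GammaSeq_div (hσ : 0 < σ) (hτ : 0 < τ) {n : ℕ} (hn : n ≠ 0) :
    growth σ τ (n + 1) = Real.GammaSeq τ n / Real.GammaSeq (τ + σ) n * (n : ℝ) ^ σ := by
  have hgrowth : growth σ τ (n + 1) = (∏ j ∈ Finset.range (n + 1), (τ + σ + j)) /
      ∏ j ∈ Finset.range (n + 1), (τ + j) := by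
    rw [growth, ← Finset.prod_div_distrib]
    refine Finset.prod_congr rfl fun i _ => ?_
    have : τ + i ≠ 0 := by positivity
    field_simp
    ring
  have hnum : (∏ j ∈ Finset.range (n + 1), (τ + σ + j)) ≠ 0 :=
    (Finset.prod_pos fun i _ => by positivity).ne'
  have hden : (∏ j ∈ Finset.range (n + 1), (τ + j)) ≠ 0 :=
    (Finset.prod_pos fun i _ => by positivity).ne'
  have hn' : (0 : ℝ) < n := by positivity
  rw [hgrowth, Real.GammaSeq, Real.GammaSeq, Real.rpow_add hn']
  field_simp

lemma tendsto_growth_div_rpow (hσ : 0 < σ) (hτ : 0 < τ) :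
    Tendsto (fun n : ℕ => growth σ τ n / (n : ℝ) ^ σ) atTop
      (𝓝 (Real.Gamma τ / Real.Gamma (τ + σ))) := by
  have hratio := (Real.GammaSeq_tendsto_Gamma τ).div (Real.GammaSeq_tendsto_Gamma (τ + σ))
    (Real.Gamma_pos_of_pos (by positivity)).ne'
  have hfactor : Tendsto (fun n : ℕ => 1 + σ / (τ + n)) atTop (𝓝 (1 + 0)) :=
    tendsto_const_nhds.add
      ((tendsto_atTop_add_const_left _ _ tendsto_natCast_atTop_atTop).const_div_atTop _)
  have hquot := hratio.div hfactor (by norm_num)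
  rw [add_zero, div_one] at hquot
  refine hquot.congr' ((eventually_ne_atTop 0).mono fun n hn => ?_)
  have hpow : (n : ℝ) ^ σ ≠ 0 := by positivity
  have hne : 1 + σ / (τ + n) ≠ 0 := by positivity
  rw [Pi.div_apply, Pi.div_apply, div_eq_div_iff hne hpow, ← growth_succ,
    growth_succ_eq_GammaSeq_div hσ hτ hn]

lemma summable_inv_growth_sq (hσ : 1 / 2 < σ) (hτ : 0 < τ) :
    Summable fun n : ℕ => (growth σ τ n ^ 2)⁻¹ := by
  have hσ0 : 0 < σ := by linarith
  have hlim : Real.Gamma τ / Real.Gamma (τ + σ) ≠ 0 :=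
    (div_pos (Real.Gamma_pos_of_pos hτ) (Real.Gamma_pos_of_pos (by positivity))).ne'
  refine summable_of_isBigO_nat (Real.summable_nat_rpow_inv.2 (by linarith : 1 < 2 * σ)) ?_
  refine Asymptotics.isBigO_of_div_tendsto_nhds ?_ _
    ((((tendsto_growth_div_rpow hσ0 hτ).inv₀ hlim).pow 2).congr fun n => ?_)
  · filter_upwards [eventually_ne_atTop 0] with n hn hzero
    exact absurd hzero (by positivity)
  · rw [Pi.div_apply, mul_comm, Real.rpow_mul n.cast_nonneg, Real.rpow_two, inv_div, div_pow,
      div_eq_mul_inv, inv_div_inv, div_eq_mul_inv]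

end Growth

/-- The number of balls of the composition `x`, measured in units of the number `a + b` of balls
added at each draw. -/
noncomputable def shape (a b : ℕ) (x : ℕ × ℕ) : ℝ := total x / (a + b)

section Moments

variable {a b c d : ℕ}

lemma shape_add (a b : ℕ) (x y : ℕ × ℕ) : shape a b (x + y) = shape a b x + shape a b y := by
  rw [shape, shape, shape, total_add, Nat.cast_add, add_div]

lemma shape_pos (hS : 0 < a + b) {x : ℕ × ℕ} (hx : x ≠ 0) : 0 < shape a b x :=
  div_pos (by exact_mod_cast total_pos_iff.2 hx) (by exact_mod_cast hS)

lemma shape_eq_one (hS : 0 < a + b) {x : ℕ × ℕ} (hx : total x = a + b) : shape a b x = 1 := by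
  rw [shape, hx, Nat.cast_add]
  exact div_self (by exact_mod_cast hS.ne')

lemma add_pos_of_sigma_pos (hσ : 0 < sigma a b c) : 0 < a + b := by
  refine Nat.pos_of_ne_zero fun h => hσ.ne' ?_
  rw [sigma, ← Nat.cast_add, h, Nat.cast_zero, div_zero]

lemma u₂_add (a b c : ℕ) (x y : ℕ × ℕ) : u₂ a b c (x + y) = u₂ a b c x + u₂ a b c y := by
  simp only [u₂, Prod.fst_add, Prod.snd_add]
  push_cast
  ring

lemma transition_u₂ (hbal : a + b = c + d) (hS : 0 < a + b) {x : ℕ × ℕ} (hx : x ≠ 0) :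
    transition a b c d (u₂ a b c) x = u₂ a b c x * (1 + sigma a b c / shape a b x) := by
  have hT : (x.1 + x.2 : ℝ) ≠ 0 := by exact_mod_cast (total_pos_iff.2 hx).ne'
  have hS' : (a : ℝ) + b ≠ 0 := by exact_mod_cast hS.ne'
  have hd : (d : ℝ) = a + b - c := by
    rw [eq_sub_iff_add_eq']
    exact_mod_cast hbal.symm
  rw [transition_apply _ _ _ _ _ hx]
  simp only [u₂, sigma, shape, total, eigm, smul_eq_mul, Prod.fst_add, Prod.snd_add]
  push_cast
  rw [hd]
  field_simp
  ring

lemma transition_u₂_sq_le (hbal : a + b = c + d) (hS : 0 < a + b) {x : ℕ × ℕ} (hx : x ≠ 0) :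
    transition a b c d (fun y => u₂ a b c y ^ 2) x ≤
      (u₂ a b c x * (1 + sigma a b c / shape a b x)) ^ 2 +
        (u₂ a b c (a, b) ^ 2 + u₂ a b c (c, d) ^ 2) := by
  have hmean := transition_u₂ hbal hS hx
  rw [transition_apply _ _ _ _ _ hx] at hmean ⊢
  have hsum := fst_div_total_add_snd_div_total hx
  have hred : 0 ≤ (x.1 : ℝ) / total x := by positivity
  have hblack : 0 ≤ (x.2 : ℝ) / total x := by positivity
  simp only [u₂_add, smul_eq_mul] at hmean ⊢
  generalize (x.1 : ℝ) / total x = α at *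
  generalize (x.2 : ℝ) / total x = β at *
  generalize u₂ a b c x = u at *
  generalize u₂ a b c (a, b) = p at *
  generalize u₂ a b c (c, d) = q at *
  generalize sigma a b c / shape a b x = μ at *
  obtain rfl : β = 1 - α := by linarith
  have hincr : α * p + (1 - α) * q = u * μ := by linear_combination hmean
  have hsq : α * (u + p) ^ 2 + (1 - α) * (u + q) ^ 2 =
      (u * (1 + μ)) ^ 2 + (α * p ^ 2 + (1 - α) * q ^ 2) - (u * μ) ^ 2 := by
    linear_combination 2 * u * hincr
  nlinarith [sq_nonneg (u * μ), mul_nonneg hred (sq_nonneg q), mul_nonneg hblack (sq_nonneg p)]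

end Moments

section Martingale

variable {a b c d : ℕ} {init : ℕ × ℕ} {Ω : Type*} [MeasurableSpace Ω] {P : Measure Ω}
  {U : ℕ → Ω → ℕ × ℕ}

/-- The second projection of the urn divided by the growth of its mean. -/
noncomputable def normalizedProj (a b c : ℕ) (init : ℕ × ℕ) (U : ℕ → Ω → ℕ × ℕ) (n : ℕ) (ω : Ω) :
    ℝ :=
  u₂ a b c (U n ω) / growth (sigma a b c) (shape a b init) n

/-- The ratio of the limit of `normProj` to the limit of `normalizedProj`. -/
noncomputable def limitFactor (a b c : ℕ) (x : ℕ × ℕ) : ℝ :=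
  Real.Gamma (shape a b x) / Real.Gamma (shape a b x + sigma a b c)

lemma limitFactor_pos (hσ : 0 < sigma a b c) {x : ℕ × ℕ} (hx : x ≠ 0) :
    0 < limitFactor a b c x := by
  have hτ := shape_pos (add_pos_of_sigma_pos hσ) hx
  exact div_pos (Real.Gamma_pos_of_pos hτ) (Real.Gamma_pos_of_pos (by positivity))

namespace IsUrnProcess

lemma normalizedProj_zero_ae_eq (hU : IsUrnProcess a b c d init P U) :
    normalizedProj a b c init U 0 =ᵐ[P] fun _ => u₂ a b c init :=
  hU.start.mono fun ω hω => by
    rw [normalizedProj, hω, growth, Finset.prod_range_zero, div_one]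

variable [IsProbabilityMeasure P]

lemma ae_ne_zero_and_shape (hU : IsUrnProcess a b c d init P U) (hbal : a + b = c + d)
    (hS : 0 < a + b) (h : init ≠ 0) (n : ℕ) :
    ∀ᵐ ω ∂P, U n ω ≠ 0 ∧ shape a b (U n ω) = shape a b init + n := by
  filter_upwards [hU.ae_total h hbal n] with ω hω
  refine ⟨?_, ?_⟩
  · rw [← total_pos_iff] at h ⊢
    omega
  · have hS' : (a : ℝ) + b ≠ 0 := by exact_mod_cast hS.ne'
    rw [shape, shape, hω]
    push_cast
    field_simp

lemma memLp_comp (hU : IsUrnProcess a b c d init P U) (hbal : a + b = c + d) (h : init ≠ 0)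
    (n : ℕ) (g : ℕ × ℕ → ℝ) (p : ENNReal) : MemLp (fun ω => g (U n ω)) p P := by
  set N := total init + n * (a + b)
  refine .of_bound (hU.aestronglyMeasurable_comp g n)
    (∑ y ∈ Finset.range (N + 1) ×ˢ Finset.range (N + 1), ‖g y‖) ?_
  filter_upwards [hU.ae_total h hbal n] with ω hω
  refine Finset.single_le_sum (f := fun y => ‖g y‖) (fun _ _ => norm_nonneg _) ?_
  rw [total] at hω
  simp only [Finset.mem_product, Finset.mem_range]
  omega

lemma integrable_comp (hU : IsUrnProcess a b c d init P U) (hbal : a + b = c + d) (h : init ≠ 0)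
    (n : ℕ) (g : ℕ × ℕ → ℝ) : Integrable (fun ω => g (U n ω)) P :=
  memLp_one_iff_integrable.1 (hU.memLp_comp hbal h n g 1)

lemma martingale (hU : IsUrnProcess a b c d init P U) (hbal : a + b = c + d)
    (hσ : 0 < sigma a b c) (h : init ≠ 0) :
    Martingale (normalizedProj a b c init U) hU.filtration P := by
  have hS := add_pos_of_sigma_pos hσ
  refine martingale_nat
    (fun n => (stronglyMeasurable_of_composition fun x => u₂ a b c x / _).comp_measurable
      (hU.measurable_filtration n))
    (fun n => hU.integrable_comp hbal h n fun x => u₂ a b c x / _) fun n => ?_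
  set G := growth (sigma a b c) (shape a b init)
  have hcond := hU.condExp_comp_succ h n (fun x => u₂ a b c x / G (n + 1))
    (hU.integrable_comp hbal h (n + 1) fun x => u₂ a b c x / G (n + 1))
  refine (hcond.trans ?_).symm
  filter_upwards [hU.ae_ne_zero_and_shape hbal hS h n] with ω ⟨hne, hshape⟩
  have hmean := transition_u₂ hbal hS hne
  rw [hshape] at hmean
  have hτ := shape_pos hS h
  have hfactor : 1 + sigma a b c / (shape a b init + n) ≠ 0 := by positivity
  calc transition a b c d (fun x => u₂ a b c x / G (n + 1)) (U n ω)
      = transition a b c d (u₂ a b c) (U n ω) / G (n + 1) := integral_div _ _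
    _ = u₂ a b c (U n ω) / G n := by
        rw [hmean, show G (n + 1) = _ from growth_succ n, mul_div_mul_right _ _ hfactor]

lemma integral_normalizedProj_sq_succ_le (hU : IsUrnProcess a b c d init P U)
    (hbal : a + b = c + d) (hσ : 0 < sigma a b c) (h : init ≠ 0) (n : ℕ) :
    ∫ ω, normalizedProj a b c init U (n + 1) ω ^ 2 ∂P ≤
      (∫ ω, normalizedProj a b c init U n ω ^ 2 ∂P) +
        (u₂ a b c (a, b) ^ 2 + u₂ a b c (c, d) ^ 2) *
          (growth (sigma a b c) (shape a b init) (n + 1) ^ 2)⁻¹ := by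
  have hS := add_pos_of_sigma_pos hσ
  have hτ := shape_pos hS h
  set B := u₂ a b c (a, b) ^ 2 + u₂ a b c (c, d) ^ 2
  set G := growth (sigma a b c) (shape a b init)
  have hG : 0 < G (n + 1) := growth_pos hσ hτ (n + 1)
  have hstep : ∫ ω, normalizedProj a b c init U (n + 1) ω ^ 2 ∂P =
      ∫ ω, transition a b c d (fun y => u₂ a b c y ^ 2) (U n ω) / G (n + 1) ^ 2 ∂P := by
    simp only [normalizedProj, div_pow, integral_div]
    rw [hU.integral_comp_succ h n (fun y => u₂ a b c y ^ 2)
      (hU.integrable_comp hbal h (n + 1) fun y => u₂ a b c y ^ 2)]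
  have hadd : (∫ ω, normalizedProj a b c init U n ω ^ 2 ∂P) + B * (G (n + 1) ^ 2)⁻¹ =
      ∫ ω, (normalizedProj a b c init U n ω ^ 2 + B * (G (n + 1) ^ 2)⁻¹) ∂P := by
    have hgint : Integrable (fun ω => normalizedProj a b c init U n ω ^ 2) P :=
      hU.integrable_comp hbal h n fun x => (u₂ a b c x / G n) ^ 2
    rw [integral_add hgint (integrable_const _), integral_const, probReal_univ, one_smul]
  rw [hstep, hadd]
  refine integral_mono_ae
    (hU.integrable_comp hbal h n fun x => transition a b c d (fun y => u₂ a b c y ^ 2) x / _)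
    (hU.integrable_comp hbal h n fun x => (u₂ a b c x / G n) ^ 2 + _) ?_
  filter_upwards [hU.ae_ne_zero_and_shape hbal hS h n] with ω ⟨hne, hshape⟩
  have hsq := transition_u₂_sq_le hbal hS hne
  rw [hshape] at hsq
  have hfactor : 1 + sigma a b c / (shape a b init + n) ≠ 0 := by positivity
  calc transition a b c d (fun y => u₂ a b c y ^ 2) (U n ω) / G (n + 1) ^ 2
      ≤ ((u₂ a b c (U n ω) * (1 + sigma a b c / (shape a b init + n))) ^ 2 + B) / G (n + 1) ^ 2 :=
        div_le_div_of_nonneg_right hsq (by positivity)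
    _ = (u₂ a b c (U n ω) / G n) ^ 2 + B * (G (n + 1) ^ 2)⁻¹ := by
        rw [add_div, ← div_pow, show G (n + 1) = _ from growth_succ n,
          mul_div_mul_right _ _ hfactor, ← div_eq_mul_inv]

lemma integral_normalizedProj_sq_le (hU : IsUrnProcess a b c d init P U) (hbal : a + b = c + d)
    (hσ : 0 < sigma a b c) (h : init ≠ 0) (n : ℕ) :
    ∫ ω, normalizedProj a b c init U n ω ^ 2 ∂P ≤ u₂ a b c init ^ 2 +
      ∑ i ∈ Finset.range n, (u₂ a b c (a, b) ^ 2 + u₂ a b c (c, d) ^ 2) *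
        (growth (sigma a b c) (shape a b init) (i + 1) ^ 2)⁻¹ := by
  induction n with
  | zero =>
    rw [integral_congr_ae (hU.normalizedProj_zero_ae_eq.mono fun ω hω => congrArg (· ^ 2) hω),
      integral_const, probReal_univ, one_smul, Finset.sum_range_zero, add_zero]
  | succ n ih =>
    rw [Finset.sum_range_succ, ← add_assoc]
    exact (hU.integral_normalizedProj_sq_succ_le hbal hσ h n).trans (add_le_add_left ih _)

lemma uniformIntegrable (hU : IsUrnProcess a b c d init P U) (hbal : a + b = c + d)
    (hσ : 1 / 2 < sigma a b c) (h : init ≠ 0) :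
    UniformIntegrable (normalizedProj a b c init U) 1 P := by
  have hσ0 : 0 < sigma a b c := by linarith
  have hτ := shape_pos (add_pos_of_sigma_pos hσ0) h
  have hsum := ((summable_nat_add_iff 1).2 (summable_inv_growth_sq hσ hτ)).mul_left
    (u₂ a b c (a, b) ^ 2 + u₂ a b c (c, d) ^ 2)
  exact uniformIntegrable_of_integral_sq_le
    (fun n => hU.memLp_comp hbal h n (fun x => u₂ a b c x / _) 2) fun n =>
      (hU.integral_normalizedProj_sq_le hbal hσ0 h n).trans
        (add_le_add_right (hsum.sum_le_tsum _ fun i _ => by positivity) _)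

/-- The almost sure and mean limit of the martingale `normalizedProj`. -/
noncomputable def limit (hU : IsUrnProcess a b c d init P U) : Ω → ℝ :=
  hU.filtration.limitProcess (normalizedProj a b c init U) P

lemma ae_tendsto_normProj_limit (hU : IsUrnProcess a b c d init P U) (hbal : a + b = c + d)
    (hσ : 1 / 2 < sigma a b c) (h : init ≠ 0) :
    ∀ᵐ ω ∂P, Tendsto (fun n => normProj a b c U n ω) atTop
      (𝓝 (hU.limit ω * limitFactor a b c init)) := by
  have hσ0 : 0 < sigma a b c := by linarith
  have hτ := shape_pos (add_pos_of_sigma_pos hσ0) h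
  have hmart := (hU.martingale hbal hσ0 h).submartingale
  filter_upwards [hmart.ae_tendsto_limitProcess_of_uniformIntegrable
    (hU.uniformIntegrable hbal hσ h)] with ω hω
  refine (hω.mul (tendsto_growth_div_rpow hσ0 hτ)).congr fun n => ?_
  rw [normalizedProj, normProj, div_mul_div_cancel₀ (growth_pos hσ0 hτ n).ne']

lemma W_ae_eq (hU : IsUrnProcess a b c d init P U) (hbal : a + b = c + d)
    (hσ : 1 / 2 < sigma a b c) (h : init ≠ 0) :
    W a b c U =ᵐ[P] fun ω => hU.limit ω * limitFactor a b c init :=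
  (hU.ae_tendsto_normProj_limit hbal hσ h).mono fun _ hω => hω.limUnder_eq

theorem ae_tendsto_normProj (hU : IsUrnProcess a b c d init P U) (hbal : a + b = c + d)
    (hσ : 1 / 2 < sigma a b c) (h : init ≠ 0) :
    ∀ᵐ ω ∂P, Tendsto (fun n => normProj a b c U n ω) atTop (𝓝 (W a b c U ω)) := by
  filter_upwards [hU.ae_tendsto_normProj_limit hbal hσ h, hU.W_ae_eq hbal hσ h] with ω hlim hW
  rwa [hW]

lemma aemeasurable_W (hU : IsUrnProcess a b c d init P U) (hbal : a + b = c + d)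
    (hσ : 1 / 2 < sigma a b c) (h : init ≠ 0) : AEMeasurable (W a b c U) P :=
  aemeasurable_of_tendsto_metrizable_ae atTop
    (fun n => (hU.aestronglyMeasurable_comp (fun x => u₂ a b c x / _) n).aemeasurable)
    (hU.ae_tendsto_normProj hbal hσ h)

lemma integral_W (hU : IsUrnProcess a b c d init P U) (hbal : a + b = c + d)
    (hσ : 1 / 2 < sigma a b c) (h : init ≠ 0) :
    ∫ ω, W a b c U ω ∂P = limitFactor a b c init * u₂ a b c init := by
  have hmart := hU.martingale hbal (by linarith) h
  have hmean : ∫ ω, hU.limit ω ∂P = u₂ a b c init := by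
    rw [limit, ← integral_condExp (hU.filtration.le 0),
      ← integral_congr_ae (hmart.ae_eq_condExp_limitProcess (hU.uniformIntegrable hbal hσ h) 0),
      integral_congr_ae hU.normalizedProj_zero_ae_eq, integral_const, probReal_univ, one_smul]
  rw [integral_congr_ae (hU.W_ae_eq hbal hσ h), integral_mul_const, hmean, mul_comm]

end IsUrnProcess

end Martingale

/-! ### Moments of the beta distribution -/

section Beta

variable {α β : ℝ}

lemma measurable_betaPDF (α β : ℝ) : Measurable (betaPDF α β) :=
  (measurable_betaPDFReal α β).ennreal_ofReal

lemma ae_betaMeasure_mem_Ioo (α β : ℝ) : ∀ᵐ v ∂betaMeasure α β, v ∈ Set.Ioo (0 : ℝ) 1 := by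
  rw [betaMeasure, ae_withDensity_iff (measurable_betaPDF α β)]
  refine ae_of_all _ fun v hv => ⟨?_, ?_⟩
  · by_contra! h
    exact hv (betaPDF_eq_zero_of_nonpos h)
  · by_contra! h
    exact hv (betaPDF_eq_zero_of_one_le h)

lemma betaMeasure_pos (hα : 0 < α) (hβ : 0 < β) {s : Set ℝ} (hs : s ⊆ Set.Ioo 0 1)
    (hs' : IsOpen s) (hne : s.Nonempty) : 0 < betaMeasure α β s := by
  rw [pos_iff_ne_zero, betaMeasure, ne_eq, withDensity_apply _ hs'.measurableSet,
    setLIntegral_eq_zero_iff hs'.measurableSet (measurable_betaPDF α β)]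
  intro hzero
  refine (hs'.measure_pos volume hne).ne' (measure_eq_zero_iff_ae_notMem.2 ?_)
  filter_upwards [hzero] with v hv0 hv
  exact (ENNReal.ofReal_pos.2 (betaPDFReal_pos (hs hv).1 (hs hv).2 hα hβ)).ne' (hv0 hv)

lemma rpow_mul_rpow_nonneg_ae (α β p q : ℝ) :
    0 ≤ᵐ[betaMeasure α β] fun v => v ^ p * (1 - v) ^ q := by
  filter_upwards [ae_betaMeasure_mem_Ioo α β] with v hv
  exact mul_nonneg (Real.rpow_nonneg hv.1.le _) (Real.rpow_nonneg (sub_nonneg.2 hv.2.le) _)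

lemma lintegral_rpow_mul_rpow_betaMeasure {p q : ℝ} (hα : 0 < α) (hβ : 0 < β) (hp : 0 < α + p)
    (hq : 0 < β + q) :
    ∫⁻ v, ENNReal.ofReal (v ^ p * (1 - v) ^ q) ∂betaMeasure α β =
      ENNReal.ofReal (beta (α + p) (β + q) / beta α β) := by
  rw [betaMeasure, lintegral_withDensity_eq_lintegral_mul _
    (measurable_betaPDF α β) (by fun_prop), ← mul_one (ENNReal.ofReal (_ / _)),
    ← lintegral_betaPDF_eq_one hp hq, ← lintegral_const_mul _ (measurable_betaPDF _ _)]
  refine lintegral_congr fun v => ?_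
  have hB := beta_pos hα hβ
  have hB' := beta_pos hp hq
  rw [Pi.mul_apply, betaPDF_eq, betaPDF_eq]
  split_ifs with hv
  · have hv0 := hv.1
    have hv1 : 0 < 1 - v := by linarith [hv.2]
    rw [← ENNReal.ofReal_mul (by positivity), ← ENNReal.ofReal_mul (by positivity),
      add_sub_right_comm α, add_sub_right_comm β, Real.rpow_add hv0, Real.rpow_add hv1]
    congr 1
    field_simp
  · rw [ENNReal.ofReal_zero, zero_mul, mul_zero]

lemma integrable_rpow_mul_rpow_betaMeasure {p q : ℝ} (hα : 0 < α) (hβ : 0 < β) (hp : 0 < α + p)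
    (hq : 0 < β + q) : Integrable (fun v => v ^ p * (1 - v) ^ q) (betaMeasure α β) := by
  refine ⟨Measurable.aestronglyMeasurable (by fun_prop), ?_⟩
  rw [hasFiniteIntegral_iff_ofReal (rpow_mul_rpow_nonneg_ae α β p q),
    lintegral_rpow_mul_rpow_betaMeasure hα hβ hp hq]
  exact ENNReal.ofReal_lt_top

lemma integral_rpow_mul_rpow_betaMeasure {p q : ℝ} (hα : 0 < α) (hβ : 0 < β) (hp : 0 < α + p)
    (hq : 0 < β + q) :
    ∫ v, v ^ p * (1 - v) ^ q ∂betaMeasure α β = beta (α + p) (β + q) / beta α β := by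
  rw [integral_eq_lintegral_of_nonneg_ae (rpow_mul_rpow_nonneg_ae α β p q)
      (Measurable.aestronglyMeasurable (by fun_prop)),
    lintegral_rpow_mul_rpow_betaMeasure hα hβ hp hq,
    ENNReal.toReal_ofReal (div_pos (beta_pos hp hq) (beta_pos hα hβ)).le]

lemma integrable_pow_mul_pow_betaMeasure (hα : 0 < α) (hβ : 0 < β) (k l : ℕ) :
    Integrable (fun v => v ^ k * (1 - v) ^ l) (betaMeasure α β) := by
  simpa only [Real.rpow_natCast] using integrable_rpow_mul_rpow_betaMeasure hα hβ
    (p := k) (q := l) (by positivity) (by positivity)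

lemma Gamma_add_natCast (hα : 0 < α) (n : ℕ) :
    Real.Gamma (α + n) = (ascPochhammer ℝ n).eval α * Real.Gamma α := by
  induction n with
  | zero => simp
  | succ n ih =>
    rw [ascPochhammer_succ_eval, Nat.cast_succ, ← add_assoc,
      Real.Gamma_add_one (by positivity), ih]
    ring

lemma integral_pow_mul_pow_betaMeasure (hα : 0 < α) (hβ : 0 < β) (k l : ℕ) :
    ∫ v, v ^ k * (1 - v) ^ l ∂betaMeasure α β =
      (ascPochhammer ℝ k).eval α * (ascPochhammer ℝ l).eval β /
        (ascPochhammer ℝ (k + l)).eval (α + β) := by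
  have hmoment := integral_rpow_mul_rpow_betaMeasure hα hβ (p := k) (q := l)
    (by positivity) (by positivity)
  simp only [Real.rpow_natCast] at hmoment
  have hΓα := (Real.Gamma_pos_of_pos hα).ne'
  have hΓβ := (Real.Gamma_pos_of_pos hβ).ne'
  have hΓ := (Real.Gamma_pos_of_pos (add_pos hα hβ)).ne'
  have hpoch := (ascPochhammer_pos (k + l) _ (add_pos hα hβ)).ne'
  rw [hmoment, beta, beta, Gamma_add_natCast hα, Gamma_add_natCast hβ, add_add_add_comm,
    ← Nat.cast_add, Gamma_add_natCast (add_pos hα hβ)]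
  field_simp

end Beta

/-! ### The branching property in discrete time -/

section Generator

/-- The transition operator multiplied by the number of balls, in units of the number `a + b` of
balls added at each draw. It satisfies the Leibniz rule on functions of `x + y`. -/
noncomputable def generator (a b c d : ℕ) (g : ℕ × ℕ → ℂ) (x : ℕ × ℕ) : ℂ :=
  (x.1 * g (x + (a, b)) + x.2 * g (x + (c, d))) / (a + b)

variable {a b c d : ℕ}

lemma generator_eq_shape_mul_transition (g : ℕ × ℕ → ℂ) {x : ℕ × ℕ} (hx : x ≠ 0) :
    generator a b c d g x = shape a b x * transition a b c d g x := by
  have hT : (total x : ℂ) ≠ 0 := by exact_mod_cast (total_pos_iff.2 hx).ne'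
  rw [generator, transition_apply _ _ _ _ _ hx, shape]
  simp only [Complex.real_smul]
  push_cast
  field_simp

lemma generator_add_apply (g : ℕ × ℕ → ℂ) (x y : ℕ × ℕ) :
    generator a b c d g (x + y) =
      generator a b c d (fun z => g (z + y)) x + generator a b c d (fun z => g (x + z)) y := by
  simp only [generator, Prod.fst_add, Prod.snd_add, add_right_comm x _ y, add_assoc x y]
  push_cast
  ring

lemma generator_iterate_add {e : ℕ × ℕ → ℂ} (he : ∀ x y, e (x + y) = e x * e y) (n : ℕ)
    (x y : ℕ × ℕ) : (generator a b c d)^[n] e (x + y) =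
      ∑ ij ∈ Finset.HasAntidiagonal.antidiagonal n, (n.choose ij.1 : ℂ) *
        ((generator a b c d)^[ij.1] e x * (generator a b c d)^[ij.2] e y) := by
  induction n generalizing x y with
  | zero => simp [he]
  | succ n ih =>
    rw [Finset.sum_antidiagonal_choose_succ_mul
      (fun i j => (generator a b c d)^[i] e x * (generator a b c d)^[j] e y)]
    simp only [Function.iterate_succ_apply']
    rw [generator_add_apply, add_comm]
    congr 1
    · simp only [generator, ih, Finset.mul_sum, Finset.sum_div, ← Finset.sum_add_distrib]
      exact Finset.sum_congr rfl fun ij _ => by ring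
    · simp only [generator, ih, Finset.mul_sum, Finset.sum_div, ← Finset.sum_add_distrib]
      refine Finset.sum_congr rfl fun ij hij => ?_
      rw [← Finset.HasAntidiagonal.mem_antidiagonal.1 hij, Nat.choose_symm_add]
      ring

lemma generator_iterate_eq (hbal : a + b = c + d) (hS : 0 < a + b) (g : ℕ × ℕ → ℂ) (n : ℕ)
    {x : ℕ × ℕ} (hx : x ≠ 0) : (generator a b c d)^[n] g x =
      ((ascPochhammer ℝ n).eval (shape a b x) : ℝ) * (transition a b c d)^[n] g x := by
  induction n generalizing x with
  | zero => simp
  | succ n ih =>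
    have hred : shape a b (x + (a, b)) = shape a b x + 1 := by
      rw [shape_add, shape_eq_one hS (x := (a, b)) rfl]
    have hblack : shape a b (x + (c, d)) = shape a b x + 1 := by
      rw [shape_add, shape_eq_one hS (x := (c, d)) hbal.symm]
    rw [Function.iterate_succ_apply', Function.iterate_succ_apply',
      generator_eq_shape_mul_transition _ hx, transition_apply _ _ _ _ _ hx,
      transition_apply _ _ _ _ _ hx, ih (add_ne_zero_of_left hx _),
      ih (add_ne_zero_of_left hx _), hred, hblack, ascPochhammer_succ_left]
    simp only [Polynomial.eval_mul, Polynomial.eval_X, Polynomial.eval_comp, Polynomial.eval_add,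
      Polynomial.eval_one, Complex.real_smul]
    push_cast
    ring

/-- The probability `(i + j choose i) vⁱ (1 - v)ʲ` of `i` successes and `j` failures in `i + j`
independent trials with success probability `v`, as a function of `(i, j)`. -/
noncomputable def binomialWeight (v : ℝ) (p : ℕ × ℕ) : ℝ :=
  (p.1 + p.2).choose p.1 * (v ^ p.1 * (1 - v) ^ p.2)

lemma transition_iterate_add (hbal : a + b = c + d) (hS : 0 < a + b) {e : ℕ × ℕ → ℂ}
    (he : ∀ x y, e (x + y) = e x * e y) (n : ℕ) {x y : ℕ × ℕ} (hx : x ≠ 0) (hy : y ≠ 0) :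
    (transition a b c d)^[n] e (x + y) =
      ∫ v, ∑ p ∈ Finset.HasAntidiagonal.antidiagonal n, binomialWeight v p •
        ((transition a b c d)^[p.1] e x * (transition a b c d)^[p.2] e y)
          ∂betaMeasure (shape a b x) (shape a b y) := by
  have hα := shape_pos hS hx
  have hβ := shape_pos hS hy
  have hpoch := (ascPochhammer_pos n _ (add_pos hα hβ)).ne'
  have hleibniz := generator_iterate_add (a := a) (b := b) (c := c) (d := d) he n x y
  rw [generator_iterate_eq hbal hS e n (add_ne_zero_of_left hx y), shape_add,
    mul_comm, ← eq_div_iff (by exact_mod_cast hpoch)] at hleibniz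
  simp only [binomialWeight]
  rw [hleibniz, Finset.sum_div, integral_finsetSum _ fun p _ =>
    ((integrable_pow_mul_pow_betaMeasure hα hβ _ _).const_mul _).smul_const _]
  refine Finset.sum_congr rfl fun p hp => ?_
  rw [integral_smul_const, integral_const_mul, integral_pow_mul_pow_betaMeasure hα hβ,
    Finset.HasAntidiagonal.mem_antidiagonal.1 hp, generator_iterate_eq hbal hS e _ hx,
    generator_iterate_eq hbal hS e _ hy, Complex.real_smul]
  push_cast
  ring

end Generator

/-! ### Limit laws and their characteristic functions -/

/-- Balanced large urns with a replacement matrix that is not triangular. -/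
structure IsLarge (a b c d : ℕ) : Prop where
  balance : a + b = c + d
  b_ne_zero : b ≠ 0
  c_ne_zero : c ≠ 0
  half_lt_sigma : 1 / 2 < sigma a b c

namespace IsLarge

variable {a b c d : ℕ}

lemma sigma_pos (H : IsLarge a b c d) : 0 < sigma a b c := one_half_pos.trans H.half_lt_sigma

lemma add_pos (H : IsLarge a b c d) : 0 < a + b := add_pos_of_sigma_pos H.sigma_pos

lemma red_ne_zero (H : IsLarge a b c d) : (a, b) ≠ 0 := fun h => H.b_ne_zero (congrArg Prod.snd h)

lemma black_ne_zero (H : IsLarge a b c d) : (c, d) ≠ 0 := fun h => H.c_ne_zero (congrArg Prod.fst h)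

lemma sigma_lt_one (H : IsLarge a b c d) : sigma a b c < 1 := by
  have hS : (0 : ℝ) < a + b := by exact_mod_cast H.add_pos
  have hb : (0 : ℝ) < b := by exact_mod_cast Nat.pos_of_ne_zero H.b_ne_zero
  have hc : (0 : ℝ) < c := by exact_mod_cast Nat.pos_of_ne_zero H.c_ne_zero
  rw [sigma, div_lt_one hS, eigm]
  linarith

end IsLarge

/-- The character `x ↦ exp (i θ u₂(x))` of the additive monoid of compositions. -/
noncomputable def phase (a b c : ℕ) (θ : ℝ) (x : ℕ × ℕ) : ℂ :=
  Complex.exp (θ * u₂ a b c x * Complex.I)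

lemma norm_phase (a b c : ℕ) (θ : ℝ) (x : ℕ × ℕ) : ‖phase a b c θ x‖ = 1 := by
  rw [phase, ← Complex.ofReal_mul, Complex.norm_exp_ofReal_mul_I]

lemma phase_add (a b c : ℕ) (θ : ℝ) (x y : ℕ × ℕ) :
    phase a b c θ (x + y) = phase a b c θ x * phase a b c θ y := by
  rw [phase, phase, phase, ← Complex.exp_add, u₂_add]
  push_cast
  ring_nf

/-- The characteristic function of `u₂(U(n))` for the urn started from `x`. -/
noncomputable def projCharFun (a b c d : ℕ) (x : ℕ × ℕ) (n : ℕ) (θ : ℝ) : ℂ :=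
  (transition a b c d)^[n] (phase a b c θ) x

lemma norm_projCharFun_le (a b c d : ℕ) (x : ℕ × ℕ) (n : ℕ) (θ : ℝ) :
    ‖projCharFun a b c d x n θ‖ ≤ 1 := by
  unfold projCharFun
  induction n generalizing x with
  | zero => exact (norm_phase a b c θ x).le
  | succ n ih =>
    rw [Function.iterate_succ_apply']
    exact norm_transition_le a b c d ih x

section LimitLaw

variable {a b c d : ℕ} {init : ℕ × ℕ} {Ω : Type*} [MeasurableSpace Ω] {P : Measure Ω}
  {U : ℕ → Ω → ℕ × ℕ}

lemma IsUrnProcess.measurable_normProj (hU : IsUrnProcess a b c d init P U) (n : ℕ) :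
    Measurable (normProj a b c U n) :=
  (measurable_of_countable fun x => u₂ a b c x / (n : ℝ) ^ sigma a b c).comp (hU.measurable n)

lemma IsUrnProcess.projCharFun_eq_integral [IsProbabilityMeasure P]
    (hU : IsUrnProcess a b c d init P U) (h : init ≠ 0) (n : ℕ) (s : ℝ) :
    projCharFun a b c d init n (s / (n : ℝ) ^ sigma a b c) =
      ∫ ω, Complex.exp (s * normProj a b c U n ω * Complex.I) ∂P := by
  rw [projCharFun, ← hU.integral_comp_eq_iterate h n (fun x => (norm_phase _ _ _ _ x).le)]
  refine integral_congr_ae (ae_of_all _ fun ω => ?_)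
  simp only [phase, normProj]
  push_cast
  ring_nf

lemma IsUrnProcess.tendsto_projCharFun [IsProbabilityMeasure P]
    (hU : IsUrnProcess a b c d init P U) (H : IsLarge a b c d) (h : init ≠ 0) (s : ℝ) :
    Tendsto (fun p : ℝ × ℕ => projCharFun a b c d init p.2 (p.1 / (p.2 : ℝ) ^ sigma a b c))
      (𝓝 s ×ˢ atTop) (𝓝 (charFun (P.map (W a b c U)) s)) := by
  rw [charFun_apply_real, integral_map (hU.aemeasurable_W H.balance H.half_lt_sigma h)
    (by fun_prop)]
  simp only [hU.projCharFun_eq_integral h]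
  refine tendsto_integral_filter_of_dominated_convergence (fun _ => 1) ?_ ?_
    (integrable_const _) ?_
  · refine Eventually.of_forall fun p => Measurable.aestronglyMeasurable ?_
    have := hU.measurable_normProj p.2
    fun_prop
  · refine Eventually.of_forall fun p => ae_of_all _ fun ω => ?_
    rw [← Complex.ofReal_mul, Complex.norm_exp_ofReal_mul_I]
  · filter_upwards [hU.ae_tendsto_normProj H.balance H.half_lt_sigma h] with ω hω
    have hfst : Tendsto (fun p : ℝ × ℕ => (p.1 : ℂ)) (𝓝 s ×ˢ atTop) (𝓝 (s : ℂ)) :=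
      (Complex.continuous_ofReal.tendsto s).comp tendsto_fst
    have hsnd : Tendsto (fun p : ℝ × ℕ => (normProj a b c U p.2 ω : ℂ)) (𝓝 s ×ˢ atTop)
        (𝓝 (W a b c U ω : ℂ)) :=
      (Complex.continuous_ofReal.tendsto _).comp (hω.comp tendsto_snd)
    exact (Complex.continuous_exp.tendsto _).comp ((hfst.mul hsnd).mul_const _)

/-- The law of the limit `W` for the urn started from `x`; the junk value `dirac 0` is taken for
the empty urn. -/
noncomputable def law (a b c d : ℕ) (x : ℕ × ℕ) : Measure ℝ :=
  if h : x ≠ (0, 0) then (exists_isUrnProcess a b c d x h).choose.map (W a b c fun n ω => ω n)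
  else Measure.dirac 0

lemma exists_law_eq_map (a b c d : ℕ) {x : ℕ × ℕ} (hx : x ≠ 0) :
    ∃ P : Measure (ℕ → ℕ × ℕ), IsProbabilityMeasure P ∧
      IsUrnProcess a b c d x P (fun n ω => ω n) ∧
      law a b c d x = P.map (W a b c fun n ω => ω n) :=
  have hx' : x ≠ (0, 0) := hx
  ⟨_, (exists_isUrnProcess a b c d x hx').choose_spec.1,
    (exists_isUrnProcess a b c d x hx').choose_spec.2, by rw [law, dif_pos hx']⟩

namespace IsLarge

lemma isProbabilityMeasure_law (H : IsLarge a b c d) (x : ℕ × ℕ) :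
    IsProbabilityMeasure (law a b c d x) := by
  by_cases hx : x = 0
  · rw [law, dif_neg (not_not.2 hx : ¬x ≠ (0, 0))]
    infer_instance
  · obtain ⟨P, hP, hU, hlaw⟩ := exists_law_eq_map a b c d hx
    rw [hlaw]
    exact Measure.isProbabilityMeasure_map (hU.aemeasurable_W H.balance H.half_lt_sigma hx)

lemma tendsto_projCharFun (H : IsLarge a b c d) {x : ℕ × ℕ} (hx : x ≠ 0) (s : ℝ) :
    Tendsto (fun p : ℝ × ℕ => projCharFun a b c d x p.2 (p.1 / (p.2 : ℝ) ^ sigma a b c))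
      (𝓝 s ×ˢ atTop) (𝓝 (charFun (law a b c d x) s)) := by
  obtain ⟨P, hP, hU, hlaw⟩ := exists_law_eq_map a b c d hx
  rw [hlaw]
  exact hU.tendsto_projCharFun H hx s

lemma integral_law (H : IsLarge a b c d) {x : ℕ × ℕ} (hx : x ≠ 0) :
    ∫ w, w ∂law a b c d x = limitFactor a b c x * u₂ a b c x := by
  obtain ⟨P, hP, hU, hlaw⟩ := exists_law_eq_map a b c d hx
  rw [hlaw, integral_map (hU.aemeasurable_W H.balance H.half_lt_sigma hx) (by fun_prop),
    hU.integral_W H.balance H.half_lt_sigma hx]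

end IsLarge

lemma IsUrnProcess.map_W_eq_law [IsProbabilityMeasure P] (hU : IsUrnProcess a b c d init P U)
    (H : IsLarge a b c d) (h : init ≠ 0) : P.map (W a b c U) = law a b c d init := by
  have := H.isProbabilityMeasure_law init
  have := Measure.isProbabilityMeasure_map (hU.aemeasurable_W H.balance H.half_lt_sigma h)
  refine Measure.ext_of_charFun (funext fun s => ?_)
  exact tendsto_nhds_unique (hU.tendsto_projCharFun H h s) (H.tendsto_projCharFun h s)

end LimitLaw

section FirstDraw

variable {a b c d : ℕ} {x y : ℕ × ℕ}

lemma IsLarge.tendsto_projCharFun_of_tendsto_div (H : IsLarge a b c d) (hx : x ≠ 0) {ι : Type*}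
    {l : Filter ι} {k n : ι → ℕ} {w : ℝ} (hw : 0 < w) (hn : Tendsto n l atTop)
    (hkn : Tendsto (fun i => (k i : ℝ) / n i) l (𝓝 w)) (t : ℝ) :
    Tendsto (fun i => projCharFun a b c d x (k i) (t / (n i : ℝ) ^ sigma a b c)) l
      (𝓝 (charFun (law a b c d x) (w ^ sigma a b c * t))) := by
  have hk : Tendsto k l atTop := by
    rw [← tendsto_natCast_atTop_iff (R := ℝ)]
    refine (hkn.pos_mul_atTop hw (tendsto_natCast_atTop_atTop.comp hn)).congr' ?_
    filter_upwards [hn.eventually_gt_atTop 0] with i hi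
    exact div_mul_cancel₀ _ (Nat.cast_ne_zero.2 hi.ne')
  have htime : Tendsto (fun i => (((k i : ℝ) / n i) ^ sigma a b c * t, k i)) l
      (𝓝 (w ^ sigma a b c * t) ×ˢ atTop) :=
    ((hkn.rpow_const (Or.inr H.sigma_pos.le)).mul_const t).prodMk hk
  refine ((H.tendsto_projCharFun hx _).comp htime).congr' ?_
  filter_upwards [hk.eventually_gt_atTop 0] with i hi
  have hkσ : (k i : ℝ) ^ sigma a b c ≠ 0 := (Real.rpow_pos_of_pos (Nat.cast_pos.2 hi) _).ne'
  simp only [Function.comp_apply]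
  rw [Real.div_rpow (Nat.cast_nonneg _) (Nat.cast_nonneg _)]
  congr 1
  field_simp

lemma IsLarge.charFun_law_eq_first_draw (H : IsLarge a b c d) (hx : x ≠ 0) (t : ℝ) :
    charFun (law a b c d x) t =
      ((x.1 : ℝ) / total x) • charFun (law a b c d (x + (a, b))) t +
      ((x.2 : ℝ) / total x) • charFun (law a b c d (x + (c, d))) t := by
  have hsucc {z : ℕ × ℕ} (hz : z ≠ 0) : Tendsto (fun n : ℕ =>
      projCharFun a b c d z n (t / ((n + 1 : ℕ) : ℝ) ^ sigma a b c)) atTop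
      (𝓝 (charFun (law a b c d z) t)) := by
    simpa only [Real.one_rpow, one_mul] using H.tendsto_projCharFun_of_tendsto_div hz one_pos
      (tendsto_add_atTop_nat 1) (by simpa using tendsto_natCast_div_add_atTop (𝕜 := ℝ) 1) t
  refine tendsto_nhds_unique ((H.tendsto_projCharFun hx t).comp
    (tendsto_const_nhds.prodMk (tendsto_add_atTop_nat 1)))
    (Tendsto.congr (fun n => ?_)
      (((hsucc (add_ne_zero_of_left hx (a, b))).const_smul _).add
        ((hsucc (add_ne_zero_of_left hx (c, d))).const_smul _)))
  simp only [Function.comp_apply, projCharFun, Function.iterate_succ_apply']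
  rw [transition_apply _ _ _ _ _ hx]

lemma IsLarge.law_eq_first_draw (H : IsLarge a b c d) (hx : x ≠ 0) :
    law a b c d x =
      ENNReal.ofReal ((x.1 : ℝ) / total x) • law a b c d (x + (a, b)) +
      ENNReal.ofReal ((x.2 : ℝ) / total x) • law a b c d (x + (c, d)) := by
  have := H.isProbabilityMeasure_law
  have (r : ℝ) (z : ℕ × ℕ) : IsFiniteMeasure (ENNReal.ofReal r • law a b c d z) :=
    Measure.smul_finite _ ENNReal.ofReal_ne_top
  refine Measure.ext_of_charFun (funext fun t => ?_)
  rw [H.charFun_law_eq_first_draw hx]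
  simp only [charFun_apply_real]
  rw [integral_add_measure, integral_smul_measure, integral_smul_measure,
    ENNReal.toReal_ofReal (by positivity), ENNReal.toReal_ofReal (by positivity)]
  all_goals
    refine Integrable.of_bound (C := 1) (Measurable.aestronglyMeasurable (by fun_prop))
      (ae_of_all _ fun w => ?_)
    rw [← Complex.ofReal_mul, Complex.norm_exp_ofReal_mul_I]

end FirstDraw

/-! ### The beta mixture in the limit -/

section Binomial

lemma binomialWeight_nonneg {v : ℝ} (hv : v ∈ Set.Icc (0 : ℝ) 1) (p : ℕ × ℕ) :
    0 ≤ binomialWeight v p := by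
  have := hv.1
  have := sub_nonneg.2 hv.2
  rw [binomialWeight]
  positivity

lemma sum_antidiagonal_binomialWeight (v : ℝ) (n : ℕ) :
    ∑ p ∈ Finset.HasAntidiagonal.antidiagonal n, binomialWeight v p = 1 := by
  have hbinom := (Commute.all v (1 - v)).add_pow' n
  rw [add_sub_cancel, one_pow] at hbinom
  rw [hbinom]
  refine Finset.sum_congr rfl fun p hp => ?_
  rw [binomialWeight, Finset.HasAntidiagonal.mem_antidiagonal.1 hp, nsmul_eq_mul]

lemma sum_antidiagonal_sq_mul_binomialWeight {v : ℝ} (hv : v ∈ Set.Icc (0 : ℝ) 1) {n : ℕ}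
    (hn : n ≠ 0) :
    ∑ p ∈ Finset.HasAntidiagonal.antidiagonal n, (v - p.1 / n) ^ 2 * binomialWeight v p =
      v * (1 - v) / n := by
  have hvar := bernstein.variance hn ⟨v, hv⟩
  simp only [bernstein_apply, bernstein.z] at hvar
  rw [Finset.Nat.sum_antidiagonal_eq_sum_range_succ_mk, ← hvar, Finset.sum_range]
  refine Finset.sum_congr rfl fun k _ => ?_
  rw [binomialWeight, add_tsub_cancel_of_le (Nat.lt_succ_iff.1 k.2), mul_assoc]

lemma norm_sum_binomialWeight_smul_le {E : Type*} [NormedAddCommGroup E] [NormedSpace ℝ E] {v C : ℝ}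
    (hv : v ∈ Set.Icc (0 : ℝ) 1) {G : ℕ × ℕ → E} (hG : ∀ p, ‖G p‖ ≤ C) (n : ℕ) :
    ‖∑ p ∈ Finset.HasAntidiagonal.antidiagonal n, binomialWeight v p • G p‖ ≤ C := by
  refine (norm_sum_le_of_le _ fun p _ => (norm_smul_le _ _).trans ?_).trans_eq
    (b := ∑ p ∈ Finset.HasAntidiagonal.antidiagonal n, binomialWeight v p * C) ?_
  · rw [Real.norm_of_nonneg (binomialWeight_nonneg hv p)]
    exact mul_le_mul_of_nonneg_left (hG p) (binomialWeight_nonneg hv p)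
  · rw [← Finset.sum_mul, sum_antidiagonal_binomialWeight, one_mul]

/-- The filter of pairs `(i, j)` with `i + j → ∞` and `i / (i + j) → v`. -/
noncomputable def proportionFilter (v : ℝ) : Filter (ℕ × ℕ) :=
  comap (fun p => (p.1 : ℝ) / (p.1 + p.2 : ℕ)) (𝓝 v) ⊓ comap (fun p => p.1 + p.2) atTop

lemma tendsto_div_add_proportionFilter (v : ℝ) :
    Tendsto (fun p : ℕ × ℕ => (p.1 : ℝ) / (p.1 + p.2 : ℕ)) (proportionFilter v) (𝓝 v) :=
  tendsto_comap.mono_left inf_le_left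

lemma tendsto_add_proportionFilter (v : ℝ) :
    Tendsto (fun p : ℕ × ℕ => p.1 + p.2) (proportionFilter v) atTop :=
  tendsto_comap.mono_left inf_le_right

lemma tendsto_div_add_proportionFilter_snd (v : ℝ) :
    Tendsto (fun p : ℕ × ℕ => (p.2 : ℝ) / (p.1 + p.2 : ℕ)) (proportionFilter v) (𝓝 (1 - v)) := by
  refine ((tendsto_div_add_proportionFilter v).const_sub 1).congr' ?_
  filter_upwards [(tendsto_add_proportionFilter v).eventually_gt_atTop 0] with p hp
  have hp' : ((p.1 + p.2 : ℕ) : ℝ) ≠ 0 := Nat.cast_ne_zero.2 hp.ne'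
  rw [one_sub_div hp', Nat.cast_add, add_sub_cancel_left]

variable {E : Type*} [NormedAddCommGroup E] {G : ℕ × ℕ → E} {g : E} {v C ε : ℝ}

/-- Chebyshev's trick: away from the proportion `v`, the deviation is absorbed by the square. -/
lemma exists_eventually_norm_sub_le_add_sq (hG : ∀ p, ‖G p‖ ≤ C)
    (h : Tendsto G (proportionFilter v) (𝓝 g)) (hε : 0 < ε) :
    ∃ K : ℝ, ∀ᶠ n : ℕ in atTop, ∀ p ∈ Finset.HasAntidiagonal.antidiagonal n,
      ‖G p - g‖ ≤ ε + K * (v - p.1 / n) ^ 2 := by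
  have hball := h (Metric.ball_mem_nhds g hε)
  rw [mem_map, proportionFilter,
    ((Metric.nhds_basis_ball.comap _).inf (atTop_basis.comap _)).mem_iff] at hball
  obtain ⟨⟨δ, N⟩, ⟨hδ : 0 < δ, -⟩, hsub⟩ := hball
  have hC : ∀ p, ‖G p - g‖ ≤ C + ‖g‖ := fun p =>
    (norm_sub_le _ _).trans (add_le_add_left (hG p) _)
  have hC0 : 0 ≤ C + ‖g‖ := (norm_nonneg _).trans (hC 0)
  refine ⟨(C + ‖g‖) / δ ^ 2, (eventually_ge_atTop N).mono fun n hn p hp => ?_⟩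
  rw [Finset.HasAntidiagonal.mem_antidiagonal] at hp
  subst hp
  rcases lt_or_ge |(p.1 : ℝ) / (p.1 + p.2 : ℕ) - v| δ with hnear | hfar
  · have hclose : G p ∈ Metric.ball g ε := hsub ⟨hnear, hn⟩
    exact (mem_ball_iff_norm.1 hclose).le.trans (le_add_of_nonneg_right (by positivity))
  · refine (hC p).trans (le_add_of_nonneg_of_le hε.le ?_)
    rw [div_mul_eq_mul_div, le_div_iff₀ (by positivity)]
    refine mul_le_mul_of_nonneg_left ?_ hC0
    rw [← sq_abs (v - _), abs_sub_comm]
    exact pow_le_pow_left₀ hδ.le hfar 2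

/-- The law of large numbers for binomial trials, in the spirit of Bernstein's proof of the
Weierstrass theorem. -/
lemma tendsto_sum_binomialWeight_smul [NormedSpace ℝ E] (hv : v ∈ Set.Icc (0 : ℝ) 1)
    (hG : ∀ p, ‖G p‖ ≤ C) (h : Tendsto G (proportionFilter v) (𝓝 g)) :
    Tendsto (fun n => ∑ p ∈ Finset.HasAntidiagonal.antidiagonal n, binomialWeight v p • G p) atTop
      (𝓝 g) := by
  refine Metric.tendsto_nhds.2 fun ε hε => ?_
  obtain ⟨K, hK⟩ := exists_eventually_norm_sub_le_add_sq hG h (half_pos hε)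
  have hvar : Tendsto (fun n : ℕ => ε / 2 + K * (v * (1 - v) / n)) atTop (𝓝 (ε / 2)) := by
    simpa only [mul_zero, add_zero] using
      ((tendsto_const_div_atTop_nhds_zero_nat (v * (1 - v))).const_mul K).const_add (ε / 2)
  filter_upwards [hK, hvar.eventually_lt_const (half_lt_self hε), eventually_ne_atTop 0]
    with n hn hlt hn0
  calc dist (∑ p ∈ Finset.HasAntidiagonal.antidiagonal n, binomialWeight v p • G p) g
      = ‖∑ p ∈ Finset.HasAntidiagonal.antidiagonal n, binomialWeight v p • (G p - g)‖ := by
        simp only [dist_eq_norm, smul_sub, Finset.sum_sub_distrib, ← Finset.sum_smul,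
          sum_antidiagonal_binomialWeight, one_smul]
    _ ≤ ∑ p ∈ Finset.HasAntidiagonal.antidiagonal n,
          binomialWeight v p * (ε / 2 + K * (v - p.1 / n) ^ 2) := by
        refine norm_sum_le_of_le _ fun p hp => (norm_smul_le _ _).trans ?_
        rw [Real.norm_of_nonneg (binomialWeight_nonneg hv p)]
        exact mul_le_mul_of_nonneg_left (hn p hp) (binomialWeight_nonneg hv p)
    _ = ε / 2 + K * (v * (1 - v) / n) := by
        rw [← sum_antidiagonal_sq_mul_binomialWeight hv hn0, Finset.mul_sum]
        simp only [mul_add, Finset.sum_add_distrib, ← Finset.sum_mul,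
          sum_antidiagonal_binomialWeight, one_mul]
        exact congrArg _ (Finset.sum_congr rfl fun p _ => by ring)
    _ < ε := hlt

end Binomial

section Mixture

variable {a b c d : ℕ} {x y : ℕ × ℕ}

lemma isProbabilityMeasure_betaMeasure_shape (hS : 0 < a + b) (hx : x ≠ 0) (hy : y ≠ 0) :
    IsProbabilityMeasure (betaMeasure (shape a b x) (shape a b y)) :=
  isProbabilityMeasureBeta (shape_pos hS hx) (shape_pos hS hy)

lemma IsLarge.charFun_law_add (H : IsLarge a b c d) (hx : x ≠ 0) (hy : y ≠ 0) (t : ℝ) :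
    charFun (law a b c d (x + y)) t = ∫ v, charFun (law a b c d x) (v ^ sigma a b c * t) *
      charFun (law a b c d y) ((1 - v) ^ sigma a b c * t)
        ∂betaMeasure (shape a b x) (shape a b y) := by
  have := isProbabilityMeasure_betaMeasure_shape H.add_pos hx hy
  refine tendsto_nhds_unique ((H.tendsto_projCharFun (add_ne_zero_of_left hx y) t).comp
    (tendsto_const_nhds.prodMk tendsto_id)) ?_
  simp only [Function.comp_def, projCharFun, id,
    transition_iterate_add H.balance H.add_pos (phase_add a b c _) _ hx hy]
  set G : ℕ × ℕ → ℂ := fun p =>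
    projCharFun a b c d x p.1 (t / ((p.1 + p.2 : ℕ) : ℝ) ^ sigma a b c) *
    projCharFun a b c d y p.2 (t / ((p.1 + p.2 : ℕ) : ℝ) ^ sigma a b c) with hGdef
  have hG (p) : ‖G p‖ ≤ 1 := by
    rw [norm_mul]
    exact mul_le_one₀ (norm_projCharFun_le _ _ _ _ _ _ _) (norm_nonneg _)
      (norm_projCharFun_le _ _ _ _ _ _ _)
  have hsum (n : ℕ) (v : ℝ) : ∑ p ∈ Finset.HasAntidiagonal.antidiagonal n, binomialWeight v p •
      ((transition a b c d)^[p.1] (phase a b c (t / (n : ℝ) ^ sigma a b c)) x *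
        (transition a b c d)^[p.2] (phase a b c (t / (n : ℝ) ^ sigma a b c)) y) =
      ∑ p ∈ Finset.HasAntidiagonal.antidiagonal n, binomialWeight v p • G p :=
    Finset.sum_congr rfl fun p hp => by
      simp only [hGdef, projCharFun, Finset.HasAntidiagonal.mem_antidiagonal.1 hp]
  simp only [hsum]
  refine tendsto_integral_filter_of_dominated_convergence (fun _ => 1) ?_ ?_
    (integrable_const _) ?_
  · refine Eventually.of_forall fun n => Measurable.aestronglyMeasurable ?_
    simp only [binomialWeight]
    fun_prop
  · refine Eventually.of_forall fun n => ?_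
    filter_upwards [ae_betaMeasure_mem_Ioo _ _] with v hv
    exact norm_sum_binomialWeight_smul_le (Set.Ioo_subset_Icc_self hv) hG n
  · filter_upwards [ae_betaMeasure_mem_Ioo _ _] with v hv
    exact tendsto_sum_binomialWeight_smul (Set.Ioo_subset_Icc_self hv) hG
      ((H.tendsto_projCharFun_of_tendsto_div hx hv.1 (tendsto_add_proportionFilter v)
        (tendsto_div_add_proportionFilter v) t).mul
      (H.tendsto_projCharFun_of_tendsto_div hy (sub_pos.2 hv.2) (tendsto_add_proportionFilter v)
        (tendsto_div_add_proportionFilter_snd v) t))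

/-- The limit of the urn started from `x + y`, in terms of the limits `p` and `q` of the urns
started from `x` and `y` and of the asymptotic proportion `v` of the draws that concern the
former. -/
noncomputable def splitSum (σ v p q : ℝ) : ℝ := v ^ σ * p + (1 - v) ^ σ * q

lemma measurable_splitSum (σ : ℝ) :
    Measurable fun z : ℝ × ℝ × ℝ => splitSum σ z.1 z.2.1 z.2.2 := by
  unfold splitSum
  fun_prop

lemma IsLarge.law_add (H : IsLarge a b c d) (hx : x ≠ 0) (hy : y ≠ 0) :
    law a b c d (x + y) = ((betaMeasure (shape a b x) (shape a b y)).prod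
        ((law a b c d x).prod (law a b c d y))).map
        (fun z => splitSum (sigma a b c) z.1 z.2.1 z.2.2) := by
  have := H.isProbabilityMeasure_law
  have := isProbabilityMeasure_betaMeasure_shape H.add_pos hx hy
  have hmeas := measurable_splitSum (sigma a b c)
  refine Measure.ext_of_charFun (funext fun t => ?_)
  rw [H.charFun_law_add hx hy, charFun_apply_real, integral_map hmeas.aemeasurable (by fun_prop),
    integral_prod]
  · refine integral_congr_ae (ae_of_all _ fun v => ?_)
    simp only [charFun_apply_real]
    rw [← integral_prod_mul]
    refine integral_congr_ae (ae_of_all _ fun p => ?_)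
    simp only [splitSum]
    rw [← Complex.exp_add]
    push_cast
    ring_nf
  · refine Integrable.of_bound (C := 1) (Measurable.aestronglyMeasurable (by fun_prop))
      (ae_of_all _ fun p => ?_)
    rw [← Complex.ofReal_mul, Complex.norm_exp_ofReal_mul_I]

end Mixture

/-! ### Absolute continuity of the limit laws -/

section NullPreimage

lemma volume_eq_zero_of_injOn_of_mapsTo {f f' : ℝ → ℝ} {s N : Set ℝ} (hs : MeasurableSet s)
    (hderiv : ∀ v ∈ s, HasDerivWithinAt f (f' v) s v) (hne : ∀ v ∈ s, f' v ≠ 0)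
    (hinj : Set.InjOn f s) (hsN : Set.MapsTo f s N) (hN : volume N = 0) : volume s = 0 := by
  have himage := lintegral_abs_det_fderiv_eq_addHaar_image volume hs
    (fun v hv => (hderiv v hv).hasFDerivWithinAt) hinj
  rw [measure_mono_null hsN.image_subset hN, setLIntegral_eq_zero_iff' hs
    (aemeasurable_ofReal_abs_det_fderivWithin volume hs
      fun v hv => (hderiv v hv).hasFDerivWithinAt)] at himage
  refine measure_eq_zero_iff_ae_notMem.2 (himage.mono fun v hv hvs => hne v hvs ?_)
  simpa using hv hvs

lemma volume_inter_preimage_eq_zero {f f' : ℝ → ℝ} {s N : Set ℝ} (hf : Measurable f)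
    (hs : MeasurableSet s) (hderiv : ∀ v ∈ s, HasStrictDerivAt f (f' v) v)
    (hne : ∀ v ∈ s, f' v ≠ 0) (hN : volume N = 0) : volume (s ∩ f ⁻¹' N) = 0 := by
  refine measure_mono_null (Set.inter_subset_inter_right s
    (Set.preimage_mono (subset_toMeasurable volume N))) ?_
  have hN' := measurableSet_toMeasurable volume N
  rw [← measure_toMeasurable] at hN
  generalize toMeasurable volume N = M at *
  refine measure_null_of_locally_null _ fun v hv => ?_
  obtain ⟨o, hosub, ho, hvo⟩ := mem_nhds_iff.1
    ((hderiv v hv.1).eventually_left_inverse (hne v hv.1))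
  refine ⟨(s ∩ f ⁻¹' M) ∩ o, inter_mem_nhdsWithin _ (ho.mem_nhds hvo), ?_⟩
  refine volume_eq_zero_of_injOn_of_mapsTo ((hs.inter (hf hN')).inter ho.measurableSet)
    (fun w hw => (hderiv w hw.1.1).hasDerivAt.hasDerivWithinAt) (fun w hw => hne w hw.1.1)
    (Set.LeftInvOn.injOn fun w hw => hosub hw.2) (fun w hw => hw.1.2) hN

end NullPreimage

section SplitSum

variable {σ v p q : ℝ}

lemma hasStrictDerivAt_splitSum (σ p q : ℝ) (hv : v ∈ Set.Ioo (0 : ℝ) 1) :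
    HasStrictDerivAt (fun u => splitSum σ u p q)
      (σ * (v ^ (σ - 1) * p - (1 - v) ^ (σ - 1) * q)) v := by
  have hleft := Real.hasStrictDerivAt_rpow_const_of_ne hv.1.ne' σ
  have hright := (Real.hasStrictDerivAt_rpow_const_of_ne (sub_pos.2 hv.2).ne' σ).comp v
    ((hasStrictDerivAt_id v).const_sub 1)
  exact ((hleft.mul_const p).add (hright.mul_const q)).congr_deriv (by ring)

/-- Two zeros of the derivative would make `(p, q)` a solution of an invertible linear system. -/
lemma subsingleton_deriv_splitSum_eq_zero (hσ : σ < 1) (hpq : (p, q) ≠ 0) :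
    {v | v ∈ Set.Ioo (0 : ℝ) 1 ∧ v ^ (σ - 1) * p - (1 - v) ^ (σ - 1) * q = 0}.Subsingleton := by
  rintro v ⟨⟨hv, hv1⟩, hvpq⟩ w ⟨⟨hw, hw1⟩, hwpq⟩
  by_contra hvw
  wlog hlt : v < w generalizing v w
  · exact this hwpq hw hw1 hvpq hv hv1 (Ne.symm hvw) (lt_of_le_of_ne (not_lt.1 hlt) (Ne.symm hvw))
  have hleft : w ^ (σ - 1) < v ^ (σ - 1) :=
    Real.rpow_lt_rpow_of_neg hv hlt (sub_neg.2 hσ)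
  have hright : (1 - v) ^ (σ - 1) < (1 - w) ^ (σ - 1) :=
    Real.rpow_lt_rpow_of_neg (sub_pos.2 hw1) (sub_lt_sub_left hlt 1) (sub_neg.2 hσ)
  have hw0 : 0 < w ^ (σ - 1) := Real.rpow_pos_of_pos hw _
  have hv0 : 0 < (1 - v) ^ (σ - 1) := Real.rpow_pos_of_pos (sub_pos.2 hv1) _
  have hdet : w ^ (σ - 1) * (1 - v) ^ (σ - 1) < v ^ (σ - 1) * (1 - w) ^ (σ - 1) :=
    mul_lt_mul'' hleft hright hw0.le hv0.le
  have hp : p = 0 := by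
    refine (mul_eq_zero.1 (?_ : (v ^ (σ - 1) * (1 - w) ^ (σ - 1) -
      w ^ (σ - 1) * (1 - v) ^ (σ - 1)) * p = 0)).resolve_left (sub_pos.2 hdet).ne'
    linear_combination (1 - w) ^ (σ - 1) * hvpq - (1 - v) ^ (σ - 1) * hwpq
  have hq : q = 0 := by
    rw [hp, mul_zero, zero_sub, neg_eq_zero] at hvpq
    exact (mul_eq_zero.1 hvpq).resolve_left hv0.ne'
  exact hpq (by rw [hp, hq, Prod.mk_zero_zero])

lemma betaMeasure_splitSum_preimage_eq_zero (hσ : 0 < σ) (hσ1 : σ < 1) (hpq : (p, q) ≠ 0)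
    (α β : ℝ) {N : Set ℝ} (hN : volume N = 0) :
    betaMeasure α β {v | splitSum σ v p q ∈ N} = 0 := by
  have hac : betaMeasure α β ≪ volume := withDensity_absolutelyContinuous _ _
  have hcrit := subsingleton_deriv_splitSum_eq_zero hσ1 hpq
  set D := {v | v ∈ Set.Ioo (0 : ℝ) 1 ∧ v ^ (σ - 1) * p - (1 - v) ^ (σ - 1) * q = 0}
  have hregular : volume ((Set.Ioo 0 1 \ D) ∩ (fun v => splitSum σ v p q) ⁻¹' N) = 0 := by
    refine volume_inter_preimage_eq_zero ?_ (measurableSet_Ioo.diff hcrit.measurableSet)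
      (fun v hv => hasStrictDerivAt_splitSum σ p q hv.1)
      (fun v hv => mul_ne_zero hσ.ne' fun h0 => hv.2 ⟨hv.1, h0⟩) hN
    exact (measurable_splitSum σ).comp (by fun_prop : Measurable fun v : ℝ => (v, p, q))
  rw [measure_eq_zero_iff_ae_notMem]
  filter_upwards [ae_betaMeasure_mem_Ioo α β,
    hac.ae_le (measure_eq_zero_iff_ae_notMem.1 (hcrit.measure_zero volume)),
    hac.ae_le (measure_eq_zero_iff_ae_notMem.1 hregular)] with v hv hvD hvN hmem
  exact hvN ⟨⟨hv, hvD⟩, hmem⟩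

end SplitSum

lemma measure_singleton_lt_one_of_integral_ne {μ : Measure ℝ} [IsProbabilityMeasure μ] {x : ℝ}
    (h : ∫ y, y ∂μ ≠ x) : μ {x} < 1 := by
  refine prob_le_one.lt_of_ne fun hone => h ?_
  have hae : ∀ᵐ y ∂μ, y = x := (prob_compl_eq_zero_iff (measurableSet_singleton x)).2 hone
  rw [integral_congr_ae hae, integral_const, probReal_univ, one_smul]

namespace IsLarge

variable {a b c d : ℕ} {x y : ℕ × ℕ}

lemma law_add_apply_le (H : IsLarge a b c d) (hx : x ≠ 0) (hy : y ≠ 0) {N : Set ℝ}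
    (hN : volume N = 0) :
    law a b c d (x + y) N ≤ law a b c d x {0} * law a b c d y {0} := by
  have := H.isProbabilityMeasure_law
  have := isProbabilityMeasure_betaMeasure_shape H.add_pos hx hy
  have hmeas := measurable_splitSum (sigma a b c)
  refine (measure_mono (subset_toMeasurable volume N)).trans ?_
  have hM := measurableSet_toMeasurable volume N
  rw [← measure_toMeasurable] at hN
  generalize toMeasurable volume N = M at hN hM
  rw [H.law_add hx hy, Measure.map_apply hmeas hM, Measure.prod_apply_symm (hmeas hM),
    ← Measure.prod_prod, Set.singleton_prod_singleton,
    ← lintegral_indicator_one (measurableSet_singleton _)]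
  refine lintegral_mono fun z => ?_
  rcases eq_or_ne z (0, 0) with rfl | hz
  · simpa using prob_le_one
  · exact (betaMeasure_splitSum_preimage_eq_zero H.sigma_pos H.sigma_lt_one hz _ _ hN).trans_le
      zero_le

lemma law_singleton_zero_lt_one (H : IsLarge a b c d) (hx : x ≠ 0) (hu : u₂ a b c x ≠ 0) :
    law a b c d x {0} < 1 := by
  have := H.isProbabilityMeasure_law x
  refine measure_singleton_lt_one_of_integral_ne ?_
  rw [H.integral_law hx]
  exact mul_ne_zero (limitFactor_pos H.sigma_pos hx).ne' hu

lemma u₂_red_pos (H : IsLarge a b c d) : 0 < u₂ a b c (a, b) := by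
  have hb : (0 : ℝ) < b := by exact_mod_cast Nat.pos_of_ne_zero H.b_ne_zero
  have hu : u₂ a b c (a, b) = b * sigma a b c := by
    rw [u₂, sigma, eigm]
    ring
  rw [hu]
  exact mul_pos hb H.sigma_pos

lemma u₂_black_neg (H : IsLarge a b c d) : u₂ a b c (c, d) < 0 := by
  have hc : (0 : ℝ) < c := by exact_mod_cast Nat.pos_of_ne_zero H.c_ne_zero
  have hbal : (a : ℝ) + b = c + d := by exact_mod_cast H.balance
  have hu : u₂ a b c (c, d) = -(c * sigma a b c) := by
    rw [u₂, sigma, eigm, show (d : ℝ) = a + b - c by linarith]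
    ring
  rw [hu]
  exact neg_neg_of_pos (mul_pos hc H.sigma_pos)

/-- Splitting after the first draw gives `P(X = 0) ≤ P(X = 0) θ` with `θ < 1`. -/
lemma law_singleton_zero (H : IsLarge a b c d) (hx : x ≠ 0) : law a b c d x {0} = 0 := by
  have := H.isProbabilityMeasure_law x
  have hadd {z : ℕ × ℕ} (hz : z ≠ 0) := H.law_add_apply_le hx hz Real.volume_singleton (N := {0})
  set θ := max (law a b c d (a, b) {0}) (law a b c d (c, d) {0})
  have hθ : θ < 1 := max_lt (H.law_singleton_zero_lt_one H.red_ne_zero H.u₂_red_pos.ne')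
    (H.law_singleton_zero_lt_one H.black_ne_zero H.u₂_black_neg.ne)
  have hle : law a b c d x {0} ≤ law a b c d x {0} * θ := by
    conv_lhs => rw [H.law_eq_first_draw hx]
    rw [Measure.add_apply, Measure.smul_apply, Measure.smul_apply, smul_eq_mul, smul_eq_mul]
    calc _ ≤ ENNReal.ofReal ((x.1 : ℝ) / total x) * (law a b c d x {0} * θ) +
          ENNReal.ofReal ((x.2 : ℝ) / total x) * (law a b c d x {0} * θ) := by
          gcongr
          · exact (hadd H.red_ne_zero).trans (by gcongr; exact le_max_left _ _)
          · exact (hadd H.black_ne_zero).trans (by gcongr; exact le_max_right _ _)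
      _ = law a b c d x {0} * θ := by
          rw [← add_mul, ← ENNReal.ofReal_add (by positivity) (by positivity),
            fst_div_total_add_snd_div_total hx, ENNReal.ofReal_one, one_mul]
  by_contra hne
  exact hle.not_gt ((ENNReal.mul_lt_mul_right hne (measure_ne_top _ _) hθ).trans_eq (mul_one _))

lemma law_absolutelyContinuous (H : IsLarge a b c d) (hx : x ≠ 0) : law a b c d x ≪ volume := by
  refine Measure.AbsolutelyContinuous.mk fun N _ hN => ?_
  have hnull {z : ℕ × ℕ} (hz : z ≠ 0) : law a b c d (x + z) N = 0 :=
    le_zero_iff.1 ((H.law_add_apply_le hx hz hN).trans_eq (by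
      rw [H.law_singleton_zero hx, zero_mul]))
  rw [H.law_eq_first_draw hx]
  simp [hnull H.red_ne_zero, hnull H.black_ne_zero]

end IsLarge

/-! ### Fourier analysis of absolutely continuous measures -/

section Fourier

open scoped FourierTransform Real SchwartzMap ContDiff

variable {V E : Type*} [NormedAddCommGroup V] [InnerProductSpace ℝ V] [MeasurableSpace V]
  [BorelSpace V] [NormedAddCommGroup E] [NormedSpace ℂ E]

lemma continuous_fourierInv [FiniteDimensional ℝ V] {f : V → E} (hf : Integrable f) :
    Continuous (𝓕⁻ f) :=
  VectorFourier.fourierIntegral_continuous (L := -innerₗ V) Real.continuous_fourierChar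
    continuous_inner.neg hf

variable [CompleteSpace E]

lemma integral_fourier_smul [FiniteDimensional ℝ V] {ψ : V → ℂ} {g : V → E} (hψ : Integrable ψ)
    (hg : Integrable g) : ∫ x, 𝓕 ψ x • g x = ∫ x, ψ x • 𝓕 g x := by
  have hflip := VectorFourier.integral_fourierIntegral_smul_eq_flip (L := innerₗ V)
    Real.continuous_fourierChar continuous_inner hψ hg
  rwa [flip_innerₗ] at hflip

lemma integral_fourierInv_smul [FiniteDimensional ℝ V] {ψ : V → ℂ} {g : V → E} (hψ : Integrable ψ)
    (hg : Integrable g) : ∫ x, 𝓕⁻ ψ x • g x = ∫ x, ψ x • 𝓕⁻ g x := by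
  have hflip := VectorFourier.integral_fourierIntegral_smul_eq_flip (L := -innerₗ V)
    Real.continuous_fourierChar continuous_inner.neg hψ hg
  rwa [show (-innerₗ V).flip = -innerₗ V from congrArg Neg.neg (flip_innerₗ V)] at hflip

lemma fourierInv_fourier_ae_eq [FiniteDimensional ℝ V] {f : V → E}
    (hf : Integrable f) (hfhat : Integrable (𝓕 f)) : 𝓕⁻ (𝓕 f) =ᵐ[volume] f := by
  refine ae_eq_of_integral_contDiff_smul_eq (continuous_fourierInv hfhat).locallyIntegrable
    hf.locallyIntegrable fun φ hφ hφc => ?_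
  let ψ : 𝓢(V, ℂ) := (hφc.comp_left Complex.ofReal_zero).toSchwartzMap
    (Complex.ofRealCLM.contDiff.comp hφ)
  have hψ (g : V → E) : ∫ x, φ x • g x = ∫ x, ψ x • g x :=
    integral_congr_ae (ae_of_all _ fun x => (Complex.coe_smul (φ x) (g x)).symm)
  rw [hψ, hψ, ← integral_fourierInv_smul ψ.integrable hfhat, ← SchwartzMap.fourierInv_coe,
    ← integral_fourier_smul (𝓕⁻ ψ).integrable hf, ← SchwartzMap.fourier_coe,
    FourierTransform.fourier_fourierInv_eq]

variable {μ : Measure ℝ} [IsFiniteMeasure μ]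

lemma charFun_eq_fourier_rnDeriv (hμ : μ ≪ volume) (t : ℝ) :
    charFun μ t = 𝓕 (fun x => ((μ.rnDeriv volume x).toReal : ℂ)) (-(2 * π)⁻¹ * t) := by
  rw [charFun_apply_real, ← integral_rnDeriv_smul hμ, Real.fourier_eq']
  refine integral_congr_ae (ae_of_all _ fun x => ?_)
  have hphase : -2 * π * inner ℝ x (-(2 * π)⁻¹ * t) = t * x := by
    simp only [Real.inner_apply]
    field_simp
  beta_reduce
  rw [hphase, Complex.real_smul, smul_eq_mul, Complex.ofReal_mul, mul_comm]

lemma tendsto_charFun_cocompact (hμ : μ ≪ volume) :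
    Tendsto (charFun μ) (cocompact ℝ) (𝓝 0) := by
  have hscale : -(2 * π)⁻¹ ≠ 0 := by simp [Real.pi_ne_zero]
  have hproper := (Homeomorph.mulLeft₀ _ hscale).isClosedEmbedding.tendsto_cocompact
  rw [funext (charFun_eq_fourier_rnDeriv hμ)]
  exact (Real.zero_at_infty_fourier _).comp hproper

lemma integrable_charFun_of_norm_le {C ρ : ℝ} (hρ : 1 < ρ)
    (h : ∀ t : ℝ, t ≠ 0 → ‖charFun μ t‖ ≤ C / |t| ^ ρ) : Integrable (charFun μ) := by
  have hdecay : Integrable fun t : ℝ => (1 + ‖t‖) ^ (-ρ) :=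
    integrable_one_add_norm (by simpa using hρ)
  refine continuous_charFun.locallyIntegrable.integrable_of_isBigO_cocompact
    (Asymptotics.IsBigO.of_bound (C * 2 ^ ρ) ?_) (hdecay.integrableAtFilter _)
  filter_upwards [tendsto_norm_cocompact_atTop.eventually_ge_atTop 1] with t ht
  rw [Real.norm_eq_abs] at ht
  have ht0 : 0 < |t| := one_pos.trans_le ht
  have hC : 0 ≤ C := by
    have := (norm_nonneg _).trans (h t (abs_pos.1 ht0))
    contrapose! this
    exact div_neg_of_neg_of_pos this (Real.rpow_pos_of_pos ht0 ρ)
  calc ‖charFun μ t‖ ≤ C / |t| ^ ρ := h t (abs_pos.1 ht0)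
    _ = C * 2 ^ ρ * (2 * |t|) ^ (-ρ) := by
        rw [Real.rpow_neg (by positivity), Real.mul_rpow zero_le_two ht0.le]
        field_simp
    _ ≤ C * 2 ^ ρ * ‖(1 + ‖t‖) ^ (-ρ)‖ := by
        rw [Real.norm_of_nonneg (by positivity), Real.norm_eq_abs]
        refine mul_le_mul_of_nonneg_left ?_ (by positivity)
        exact Real.rpow_le_rpow_of_nonpos (by positivity) (by linarith) (by linarith)

theorem hasBoundedContinuousDensity_of_integrable_charFun (hμ : μ ≪ volume)
    (hgint : Integrable (charFun μ)) : HasBoundedContinuousDensity μ := by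
  set f : ℝ → ℂ := fun x => ((μ.rnDeriv volume x).toReal : ℂ)
  have hfint : Integrable f := Measure.integrable_toReal_rnDeriv.ofReal
  have hfhat : Integrable (𝓕 f) := by
    refine (integrable_comp_mul_left_iff (g := 𝓕 f) (R := -(2 * π)⁻¹)
      (by simp [Real.pi_ne_zero])).1 ?_
    rwa [← funext (charFun_eq_fourier_rnDeriv hμ)]
  have hg : 𝓕⁻ (𝓕 f) =ᵐ[volume] f := fourierInv_fourier_ae_eq hfint hfhat
  have hcont : Continuous fun x => (𝓕⁻ (𝓕 f) x).re :=
    Complex.continuous_re.comp (continuous_fourierInv hfhat)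
  have hre : ∀ᵐ x, (𝓕⁻ (𝓕 f) x).re = (μ.rnDeriv volume x).toReal :=
    hg.mono fun x hx => by rw [hx, Complex.ofReal_re]
  refine ⟨hμ, _, hcont, ?_, ⟨∫ t, ‖𝓕 f t‖, fun x => ?_⟩, ?_⟩
  · have hdense : Dense {x | 0 ≤ (𝓕⁻ (𝓕 f) x).re} := Measure.dense_of_ae
      (hre.mono fun x hx => hx.symm ▸ ENNReal.toReal_nonneg)
    exact fun x => (isClosed_le continuous_const hcont).closure_subset (hdense x)
  · exact (Complex.re_le_norm _).trans (VectorFourier.norm_fourierIntegral_le_integral_norm ..)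
  · conv_lhs => rw [← Measure.withDensity_rnDeriv_eq _ _ hμ]
    refine withDensity_congr_ae ?_
    filter_upwards [hre, μ.rnDeriv_lt_top volume] with x hx hlt
    rw [hx, ENNReal.ofReal_toReal hlt.ne]

end Fourier

/-! ### Decay of the characteristic functions -/

section RandomContraction

variable {β : Measure ℝ} {φ h : ℝ → ℝ} {σ ρ : ℝ}

lemma integrable_mul_comp_one_sub_rpow {w : ℝ → ℝ} (hw : Integrable w β) (hh : Measurable h)
    (hh0 : ∀ t, 0 ≤ h t) (hh1 : ∀ t, h t ≤ 1) (σ t : ℝ) :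
    Integrable (fun v => w v * h ((1 - v) ^ σ * t)) β :=
  hw.mul_bdd (c := 1) (hh.comp (by fun_prop)).aestronglyMeasurable
    (ae_of_all _ fun v => by simpa only [Real.norm_of_nonneg (hh0 _)] using hh1 _)

lemma tendsto_integral_mul_comp_one_sub_rpow {w : ℝ → ℝ} (hβ : ∀ᵐ v ∂β, v < 1)
    (hw : Integrable w β) (hh : Measurable h) (hh0 : ∀ t, 0 ≤ h t) (hh1 : ∀ t, h t ≤ 1)
    (hlim : Tendsto h atTop (𝓝 0)) (σ : ℝ) :
    Tendsto (fun t => ∫ v, w v * h ((1 - v) ^ σ * t) ∂β) atTop (𝓝 0) := by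
  rw [← integral_zero ℝ ℝ (μ := β)]
  refine tendsto_integral_filter_of_dominated_convergence (fun v => ‖w v‖)
    (.of_forall fun t =>
      (integrable_mul_comp_one_sub_rpow hw hh hh0 hh1 σ t).aestronglyMeasurable)
    (.of_forall fun t => ae_of_all _ fun v => ?_) hw.norm ?_
  · rw [norm_mul, Real.norm_of_nonneg (hh0 _)]
    exact mul_le_of_le_one_right (norm_nonneg _) (hh1 _)
  · filter_upwards [hβ] with v hv
    have hscale : 0 < (1 - v) ^ σ := Real.rpow_pos_of_pos (sub_pos.2 hv) σ
    simpa using (hlim.comp (tendsto_id.const_mul_atTop hscale)).const_mul (w v)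

lemma rpow_mul_le_mul_integral (hβ : ∀ᵐ v ∂β, v ∈ Set.Ioo (0 : ℝ) 1) (hσ : 0 ≤ σ)
    (hw : Integrable (fun v => v ^ (-(σ * ρ))) β) (hφ0 : ∀ t, 0 ≤ φ t) (hh : Measurable h)
    (hh0 : ∀ t, 0 ≤ h t) (hh1 : ∀ t, h t ≤ 1) {K t : ℝ} (ht : 0 < t)
    (hle : φ t ≤ ∫ v, φ (v ^ σ * t) * h ((1 - v) ^ σ * t) ∂β)
    (hK : ∀ s ∈ Set.Ioc 0 t, s ^ ρ * φ s ≤ K) :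
    t ^ ρ * φ t ≤ K * ∫ v, v ^ (-(σ * ρ)) * h ((1 - v) ^ σ * t) ∂β := by
  refine (mul_le_mul_of_nonneg_left hle (Real.rpow_nonneg ht.le ρ)).trans ?_
  rw [← integral_const_mul, ← integral_const_mul]
  refine integral_mono_of_nonneg (ae_of_all _ fun v => ?_)
    ((integrable_mul_comp_one_sub_rpow hw hh hh0 hh1 σ t).const_mul K) ?_
  · exact mul_nonneg (Real.rpow_nonneg ht.le ρ) (mul_nonneg (hφ0 _) (hh0 _))
  filter_upwards [hβ] with v hv
  have hs : v ^ σ * t ∈ Set.Ioc 0 t := ⟨mul_pos (Real.rpow_pos_of_pos hv.1 σ) ht,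
    mul_le_of_le_one_left ht.le (Real.rpow_le_one hv.1.le hv.2.le hσ)⟩
  have hscale : t ^ ρ = v ^ (-(σ * ρ)) * (v ^ σ * t) ^ ρ := by
    rw [Real.mul_rpow (Real.rpow_nonneg hv.1.le σ) ht.le, ← Real.rpow_mul hv.1.le, ← mul_assoc,
      ← Real.rpow_add hv.1, neg_add_cancel, Real.rpow_zero, one_mul]
  calc t ^ ρ * (φ (v ^ σ * t) * h ((1 - v) ^ σ * t))
      = (v ^ σ * t) ^ ρ * φ (v ^ σ * t) * (v ^ (-(σ * ρ)) * h ((1 - v) ^ σ * t)) := by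
        rw [hscale]; ring
    _ ≤ K * (v ^ (-(σ * ρ)) * h ((1 - v) ^ σ * t)) :=
        mul_le_mul_of_nonneg_right (hK _ hs) (mul_nonneg (Real.rpow_nonneg hv.1.le _) (hh0 _))

/-- With `K = sup_{0 < t ≤ T} t ^ ρ φ(t)`, the contraction inequality gives
`t ^ ρ φ(t) ≤ K E[V ^ (-σρ) h((1 - V) ^ σ t)] ≤ K / 2` for all `t ∈ [T₀, T]`, where `T₀` does not
depend on `T`, so that `K ≤ T₀ ^ ρ`. -/
lemma exists_rpow_mul_le_of_le_integral (hβ : ∀ᵐ v ∂β, v ∈ Set.Ioo (0 : ℝ) 1) (hσ : 0 ≤ σ)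
    (hρ : 0 ≤ ρ) (hw : Integrable (fun v => v ^ (-(σ * ρ))) β) (hφ0 : ∀ t, 0 ≤ φ t)
    (hφ1 : ∀ t, φ t ≤ 1) (hh : Measurable h) (hh0 : ∀ t, 0 ≤ h t) (hh1 : ∀ t, h t ≤ 1)
    (hlim : Tendsto h atTop (𝓝 0))
    (hle : ∀ t, 0 < t → φ t ≤ ∫ v, φ (v ^ σ * t) * h ((1 - v) ^ σ * t) ∂β) :
    ∃ C, ∀ t, 0 < t → t ^ ρ * φ t ≤ C := by
  have hsmall := (tendsto_integral_mul_comp_one_sub_rpow (hβ.mono fun v hv => hv.2) hw hh hh0 hh1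
    hlim σ).eventually_le_const one_half_pos
  obtain ⟨T₀, hT₀⟩ := eventually_atTop.1 (hsmall.and (eventually_ge_atTop 0))
  have htrivial {t T : ℝ} (ht : 0 < t) (htT : t ≤ T) : t ^ ρ * φ t ≤ T ^ ρ :=
    (mul_le_of_le_one_right (by positivity) (hφ1 t)).trans (Real.rpow_le_rpow ht.le htT hρ)
  refine ⟨T₀ ^ ρ, fun T hT => ?_⟩
  let K := ⨆ t : Set.Ioc 0 T, (t : ℝ) ^ ρ * φ t
  have hbdd : BddAbove (Set.range fun t : Set.Ioc 0 T => (t : ℝ) ^ ρ * φ t) :=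
    ⟨T ^ ρ, Set.forall_mem_range.2 fun t => htrivial t.2.1 t.2.2⟩
  have hK {t : ℝ} (ht : t ∈ Set.Ioc 0 T) : t ^ ρ * φ t ≤ K := le_ciSup hbdd ⟨t, ht⟩
  have hK0 : 0 ≤ K := (mul_nonneg (by positivity) (hφ0 T)).trans (hK ⟨hT, le_rfl⟩)
  have hKle : K ≤ max (T₀ ^ ρ) (K / 2) := by
    have : Nonempty (Set.Ioc 0 T) := ⟨⟨T, hT, le_rfl⟩⟩
    refine ciSup_le fun ⟨t, ht⟩ => ?_
    rcases le_total t T₀ with htT₀ | hT₀t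
    · exact le_max_of_le_left (htrivial ht.1 htT₀)
    · refine le_max_of_le_right ((rpow_mul_le_mul_integral hβ hσ hw hφ0 hh hh0 hh1 ht.1
        (hle t ht.1) fun s hs => hK ⟨hs.1, hs.2.trans ht.2⟩).trans ?_)
      rw [div_eq_mul_one_div]
      exact mul_le_mul_of_nonneg_left (hT₀ t hT₀t).1 hK0
  refine (hK ⟨hT, le_rfl⟩).trans ((le_max_iff.1 hKle).elim id fun hhalf => ?_)
  exact (by linarith : K ≤ 0).trans (Real.rpow_nonneg (hT₀ T₀ le_rfl).2 ρ)

end RandomContraction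

/-- The characteristic function of `μ` is `O(|t| ^ (-ρ))`, uniformly in `t ≠ 0`. -/
def HasCharFunDecay (μ : Measure ℝ) (ρ : ℝ) : Prop :=
  ∃ C : ℝ, 0 < C ∧ ∀ t : ℝ, t ≠ 0 → ‖charFun μ t‖ ≤ C / |t| ^ ρ

namespace HasCharFunDecay

variable {μ : Measure ℝ} {ρ : ℝ}

lemma of_forall_pos {C : ℝ} (h : ∀ t, 0 < t → t ^ ρ * ‖charFun μ t‖ ≤ C) :
    HasCharFunDecay μ ρ := by
  refine ⟨max C 1, lt_max_of_lt_right one_pos, fun t ht => ?_⟩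
  have habs : ‖charFun μ |t|‖ = ‖charFun μ t‖ := by
    rcases abs_choice t with h | h <;> rw [h]
    rw [charFun_neg, RCLike.norm_conj]
  rw [le_div_iff₀' (Real.rpow_pos_of_pos (abs_pos.2 ht) ρ), ← habs]
  exact (h _ (abs_pos.2 ht)).trans (le_max_left _ _)

end HasCharFunDecay

namespace IsLarge

variable {a b c d : ℕ} {x y : ℕ × ℕ}

lemma norm_charFun_law_le_first_draw (H : IsLarge a b c d) (hx : x ≠ 0) {t B : ℝ}
    (hred : ‖charFun (law a b c d (x + (a, b))) t‖ ≤ B)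
    (hblack : ‖charFun (law a b c d (x + (c, d))) t‖ ≤ B) : ‖charFun (law a b c d x) t‖ ≤ B := by
  rw [H.charFun_law_eq_first_draw hx, ← mem_closedBall_zero_iff]
  exact convex_closedBall 0 B (mem_closedBall_zero_iff.2 hred) (mem_closedBall_zero_iff.2 hblack)
    (by positivity) (by positivity) (fst_div_total_add_snd_div_total hx)

lemma tendsto_charFun_law_atTop (H : IsLarge a b c d) (hx : x ≠ 0) :
    Tendsto (fun t => ‖charFun (law a b c d x) t‖) atTop (𝓝 0) := by
  have := H.isProbabilityMeasure_law x
  rw [← norm_zero (E := ℂ)]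
  exact ((tendsto_charFun_cocompact (H.law_absolutelyContinuous hx)).mono_left
    (atTop_le_cocompact)).norm

lemma norm_charFun_law_le_integral (H : IsLarge a b c d) (hx : x ≠ 0) (t : ℝ) :
    ‖charFun (law a b c d x) t‖ ≤
      ∫ v, ‖charFun (law a b c d x) (v ^ sigma a b c * t)‖ *
        max ‖charFun (law a b c d (a, b)) ((1 - v) ^ sigma a b c * t)‖
          ‖charFun (law a b c d (c, d)) ((1 - v) ^ sigma a b c * t)‖
        ∂betaMeasure (shape a b x) 1 := by
  set g := fun s : ℝ =>
    max ‖charFun (law a b c d (a, b)) s‖ ‖charFun (law a b c d (c, d)) s‖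
  have := H.isProbabilityMeasure_law
  have hadd {y : ℕ × ℕ} (hy : y ≠ 0) (hshape : shape a b y = 1)
      (hg : ∀ s, ‖charFun (law a b c d y) s‖ ≤ g s) :
      ‖charFun (law a b c d (x + y)) t‖ ≤ ∫ v, ‖charFun (law a b c d x) (v ^ sigma a b c * t)‖ *
        g ((1 - v) ^ sigma a b c * t) ∂betaMeasure (shape a b x) 1 := by
    have := isProbabilityMeasure_betaMeasure_shape H.add_pos hx hy
    rw [H.charFun_law_add hx hy, ← hshape]
    refine norm_integral_le_of_norm_le (Integrable.of_bound (C := 1)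
      (Measurable.aestronglyMeasurable (by fun_prop)) (ae_of_all _ fun v => ?_))
      (ae_of_all _ fun v => ?_)
    · rw [Real.norm_of_nonneg (by positivity)]
      exact mul_le_one₀ (norm_charFun_le_one _) (by positivity)
        (max_le (norm_charFun_le_one _) (norm_charFun_le_one _))
    · rw [norm_mul]
      exact mul_le_mul_of_nonneg_left (hg _) (norm_nonneg _)
  exact H.norm_charFun_law_le_first_draw hx
    (hadd H.red_ne_zero (shape_eq_one H.add_pos (x := (a, b)) rfl) fun s => le_max_left _ _)
    (hadd H.black_ne_zero (shape_eq_one H.add_pos (x := (c, d)) H.balance.symm)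
      fun s => le_max_right _ _)

lemma hasCharFunDecay_law_of_lt_shape (H : IsLarge a b c d) (hx : x ≠ 0) {ρ : ℝ} (hρ : 0 ≤ ρ)
    (hlt : sigma a b c * ρ < shape a b x) : HasCharFunDecay (law a b c d x) ρ := by
  have := H.isProbabilityMeasure_law
  have hshape := shape_pos H.add_pos hx
  have hweight : Integrable (fun v => v ^ (-(sigma a b c * ρ))) (betaMeasure (shape a b x) 1) := by
    simpa using integrable_rpow_mul_rpow_betaMeasure hshape one_pos
      (p := -(sigma a b c * ρ)) (q := 0) (by linarith) (by simp)
  have hlim : Tendsto (fun t => max ‖charFun (law a b c d (a, b)) t‖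
      ‖charFun (law a b c d (c, d)) t‖) atTop (𝓝 0) := by
    simpa only [max_self] using (H.tendsto_charFun_law_atTop H.red_ne_zero).max
      (H.tendsto_charFun_law_atTop H.black_ne_zero)
  obtain ⟨C, hC⟩ := exists_rpow_mul_le_of_le_integral
    (φ := fun t => ‖charFun (law a b c d x) t‖) (ae_betaMeasure_mem_Ioo (shape a b x) 1)
    H.sigma_pos.le hρ hweight (fun t => norm_nonneg _) (fun t => norm_charFun_le_one t)
    (by fun_prop) (fun t => by positivity)
    (fun t => max_le (norm_charFun_le_one t) (norm_charFun_le_one t)) hlim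
    fun t _ => H.norm_charFun_law_le_integral hx t
  exact .of_forall_pos hC

/-- Each draw adds `a + b` balls and hence gains `1 / σ` in the rate of decay. -/
theorem hasCharFunDecay_law (H : IsLarge a b c d) (hx : x ≠ 0) {ρ : ℝ} (hρ : 0 ≤ ρ) :
    HasCharFunDecay (law a b c d x) ρ := by
  obtain ⟨k, hk⟩ := exists_nat_gt (sigma a b c * ρ)
  replace hk : sigma a b c * ρ < shape a b x + k := by linarith [shape_pos H.add_pos hx]
  induction k generalizing x with
  | zero => exact H.hasCharFunDecay_law_of_lt_shape hx hρ (by simpa using hk)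
  | succ k ih =>
    have hshape {z : ℕ × ℕ} (hz : shape a b z = 1) :
        sigma a b c * ρ < shape a b (x + z) + k := by
      rw [shape_add, hz]
      push_cast at hk
      linarith
    obtain ⟨C, hC, hred⟩ := ih (add_ne_zero_of_left hx (a, b))
      (hshape (shape_eq_one H.add_pos (x := (a, b)) rfl))
    obtain ⟨D, -, hblack⟩ := ih (add_ne_zero_of_left hx (c, d))
      (hshape (shape_eq_one H.add_pos (x := (c, d)) H.balance.symm))
    refine ⟨max C D, lt_max_of_lt_left hC, fun t ht => ?_⟩
    refine H.norm_charFun_law_le_first_draw hx ((hred t ht).trans ?_) ((hblack t ht).trans ?_)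
    · gcongr
      exact le_max_left _ _
    · gcongr
      exact le_max_right _ _

theorem hasBoundedContinuousDensity_law (H : IsLarge a b c d) (hx : x ≠ 0) :
    HasBoundedContinuousDensity (law a b c d x) := by
  have := H.isProbabilityMeasure_law x
  obtain ⟨C, -, hC⟩ := H.hasCharFunDecay_law hx zero_le_two
  exact hasBoundedContinuousDensity_of_integrable_charFun (H.law_absolutelyContinuous hx)
    (integrable_charFun_of_norm_le one_lt_two hC)

end IsLarge

/-! ### Support of the limit laws -/

section Mean

variable {μ : Measure ℝ}

lemma exists_mem_support_pos (h : 0 < ∫ y, y ∂μ) : ∃ p ∈ μ.support, 0 < p := by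
  by_contra! hle
  refine h.not_ge (integral_nonpos_of_ae ?_)
  filter_upwards [Measure.support_mem_ae (μ := μ)] with y hy using hle y hy

lemma exists_mem_support_neg (h : ∫ y, y ∂μ < 0) : ∃ p ∈ μ.support, p < 0 := by
  by_contra! hle
  refine h.not_ge (integral_nonneg_of_ae ?_)
  filter_upwards [Measure.support_mem_ae (μ := μ)] with y hy using hle y hy

end Mean

section SplitSumClosed

variable {σ : ℝ}

lemma continuous_splitSum (hσ : 0 ≤ σ) :
    Continuous fun z : ℝ × ℝ × ℝ => splitSum σ z.1 z.2.1 z.2.2 :=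
  ((continuous_fst.rpow_const fun _ => Or.inr hσ).mul (by fun_prop)).add
    (((continuous_const.sub continuous_fst).rpow_const fun _ => Or.inr hσ).mul (by fun_prop))

lemma continuous_splitSum_left (hσ : 0 ≤ σ) (p q : ℝ) : Continuous fun v => splitSum σ v p q :=
  (continuous_splitSum hσ).comp (by fun_prop : Continuous fun v : ℝ => (v, p, q))

lemma splitSum_zero (hσ : σ ≠ 0) (p q : ℝ) : splitSum σ 0 p q = q := by
  simp [splitSum, hσ]

lemma splitSum_one (hσ : σ ≠ 0) (p q : ℝ) : splitSum σ 1 p q = p := by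
  simp [splitSum, hσ]

lemma splitSum_half_self (σ p : ℝ) : splitSum σ 2⁻¹ p p = 2 ^ (1 - σ) * p := by
  rw [splitSum, sub_eq_of_eq_add (by norm_num : (1 : ℝ) = 2⁻¹ + 2⁻¹), Real.inv_rpow zero_le_two,
    Real.rpow_sub two_pos, Real.rpow_one]
  ring

variable {K : Set ℝ}

lemma Icc_subset_of_splitSum_mem (hσ : 0 < σ)
    (hK : ∀ p ∈ K, ∀ q ∈ K, ∀ v ∈ Set.Icc (0 : ℝ) 1, splitSum σ v p q ∈ K) {p q : ℝ}
    (hp : p ∈ K) (hq : q ∈ K) : Set.Icc p q ⊆ K := by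
  have hivt := intermediate_value_Icc zero_le_one (continuous_splitSum_left hσ.le q p).continuousOn
  rw [splitSum_zero hσ.ne', splitSum_one hσ.ne'] at hivt
  exact hivt.trans (Set.image_subset_iff.2 (hK q hq p hp))

/-- Splitting in equal halves scales by `2 ^ (1 - σ) > 1`, so `K` is unbounded on both sides. -/
lemma eq_univ_of_splitSum_mem (hσ : 0 < σ) (hσ1 : σ < 1)
    (hK : ∀ p ∈ K, ∀ q ∈ K, ∀ v ∈ Set.Icc (0 : ℝ) 1, splitSum σ v p q ∈ K) {p q : ℝ}
    (hp : p ∈ K) (hp0 : 0 < p) (hq : q ∈ K) (hq0 : q < 0) : K = Set.univ := by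
  have hr : (1 : ℝ) < 2 ^ (1 - σ) := Real.one_lt_rpow one_lt_two (sub_pos.2 hσ1)
  set r : ℝ := 2 ^ (1 - σ)
  have hscale {s : ℝ} (hs : s ∈ K) (n : ℕ) : r ^ n * s ∈ K := by
    induction n with
    | zero => rwa [pow_zero, one_mul]
    | succ n ih =>
      rw [pow_succ', mul_assoc, ← splitSum_half_self]
      exact hK _ ih _ ih _ (by norm_num)
  have hgrow := tendsto_pow_atTop_atTop_of_one_lt hr
  refine Set.eq_univ_of_forall fun z => ?_
  obtain ⟨n, hqn, hpn⟩ := (((hgrow.atTop_mul_const_of_neg hq0).eventually_le_atBot z).and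
    ((hgrow.atTop_mul_const hp0).eventually_ge_atTop z)).exists
  exact Icc_subset_of_splitSum_mem hσ hK (hscale hq n) (hscale hp n) ⟨hqn, hpn⟩

end SplitSumClosed

namespace IsLarge

variable {a b c d : ℕ} {x y : ℕ × ℕ}

lemma splitSum_mem_support_law_add_of_mem_Ioo (H : IsLarge a b c d) (hx : x ≠ 0) (hy : y ≠ 0)
    {p q v : ℝ} (hp : p ∈ (law a b c d x).support) (hq : q ∈ (law a b c d y).support)
    (hv : v ∈ Set.Ioo (0 : ℝ) 1) :
    splitSum (sigma a b c) v p q ∈ (law a b c d (x + y)).support := by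
  have := H.isProbabilityMeasure_law
  have := isProbabilityMeasure_betaMeasure_shape H.add_pos hx hy
  have hcont := continuous_splitSum H.sigma_pos.le
  rw [Measure.mem_support_iff_forall] at hp hq ⊢
  intro N hN
  have hpre := hcont.continuousAt.preimage_mem_nhds (x := (v, p, q)) hN
  rw [nhds_prod_eq, nhds_prod_eq, mem_prod_iff] at hpre
  obtain ⟨A, hA, B, hB, hAB⟩ := hpre
  obtain ⟨B₁, hB₁, B₂, hB₂, hBB⟩ := mem_prod_iff.1 hB
  have hvA : v ∈ interior A ∩ Set.Ioo 0 1 := ⟨mem_interior_iff_mem_nhds.2 hA, hv⟩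
  have hA0 : 0 < betaMeasure (shape a b x) (shape a b y) A :=
    (betaMeasure_pos (shape_pos H.add_pos hx) (shape_pos H.add_pos hy) Set.inter_subset_right
      (isOpen_interior.inter isOpen_Ioo) ⟨v, hvA⟩).trans_le
      (measure_mono (Set.inter_subset_left.trans interior_subset))
  rw [H.law_add hx hy]
  refine lt_of_lt_of_le ?_ ((measure_mono ((Set.prod_mono_right hBB).trans hAB)).trans
    (Measure.le_map_apply hcont.measurable.aemeasurable N))
  rw [Measure.prod_prod, Measure.prod_prod]
  exact ENNReal.mul_pos hA0.ne' (ENNReal.mul_pos (hp _ hB₁).ne' (hq _ hB₂).ne').ne'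

lemma splitSum_mem_support_law_add (H : IsLarge a b c d) (hx : x ≠ 0) (hy : y ≠ 0)
    {p q v : ℝ} (hp : p ∈ (law a b c d x).support) (hq : q ∈ (law a b c d y).support)
    (hv : v ∈ Set.Icc (0 : ℝ) 1) :
    splitSum (sigma a b c) v p q ∈ (law a b c d (x + y)).support := by
  rw [← closure_Ioo zero_ne_one] at hv
  exact closure_minimal
    (fun w hw => H.splitSum_mem_support_law_add_of_mem_Ioo hx hy hp hq hw)
    (Measure.isClosed_support.preimage (continuous_splitSum_left H.sigma_pos.le p q)) hv

lemma support_law_mono (H : IsLarge a b c d) (hx : x ≠ 0) (hxy : x ≤ y) :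
    (law a b c d x).support ⊆ (law a b c d y).support := by
  have := H.isProbabilityMeasure_law
  obtain ⟨z, rfl⟩ := exists_add_of_le hxy
  rcases eq_or_ne z 0 with rfl | hz
  · rw [add_zero]
  intro p hp
  obtain ⟨q, hq⟩ := nonempty_of_mem (Measure.support_mem_ae (μ := law a b c d z))
  rw [← splitSum_one H.sigma_pos.ne' p q]
  exact H.splitSum_mem_support_law_add hx hz hp hq (by norm_num)

lemma law_red_eq (H : IsLarge a b c d) : law a b c d (1, 0) = law a b c d ((1, 0) + (a, b)) := by
  rw [H.law_eq_first_draw (by simp)]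
  simp [total]

lemma law_black_eq (H : IsLarge a b c d) :
    law a b c d (0, 1) = law a b c d ((0, 1) + (c, d)) := by
  rw [H.law_eq_first_draw (by simp)]
  simp [total]

lemma a_ne_zero (H : IsLarge a b c d) : a ≠ 0 := by
  rintro rfl
  refine H.sigma_pos.not_ge (div_nonpos_of_nonpos_of_nonneg ?_ (by positivity))
  simp [eigm]

lemma u₂_one_red_pos (H : IsLarge a b c d) : 0 < u₂ a b c (1, 0) := by
  have hb : (0 : ℝ) < b := by exact_mod_cast Nat.pos_of_ne_zero H.b_ne_zero
  simp only [u₂, Nat.cast_one, Nat.cast_zero, mul_one, mul_zero, sub_zero]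
  positivity

lemma u₂_one_black_neg (H : IsLarge a b c d) : u₂ a b c (0, 1) < 0 := by
  have hc : (0 : ℝ) < c := by exact_mod_cast Nat.pos_of_ne_zero H.c_ne_zero
  simp only [u₂, Nat.cast_one, Nat.cast_zero, mul_one, mul_zero, zero_sub, neg_div]
  exact neg_neg_of_pos (div_pos hc (by exact_mod_cast H.add_pos))

lemma support_law_red (H : IsLarge a b c d) : (law a b c d (1, 0)).support = Set.univ := by
  have hmix : (law a b c d ((1, 0) + (1, 0))).support ⊆ (law a b c d (1, 0)).support := by
    rw [H.law_red_eq]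
    have hred : ((1, 0) : ℕ × ℕ) ≤ (a, b) :=
      Prod.mk_le_mk.2 ⟨Nat.one_le_iff_ne_zero.2 H.a_ne_zero, zero_le⟩
    exact H.support_law_mono (by simp) (by gcongr)
  have hblack : (law a b c d (0, 1)).support ⊆ (law a b c d (1, 0)).support := by
    rw [H.law_red_eq]
    exact H.support_law_mono (by simp) (by simpa using Nat.one_le_iff_ne_zero.2 H.b_ne_zero)
  obtain ⟨p, hp, hp0⟩ := exists_mem_support_pos (μ := law a b c d (1, 0)) (by
    rw [H.integral_law (by simp)]
    exact mul_pos (limitFactor_pos H.sigma_pos (by simp)) H.u₂_one_red_pos)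
  obtain ⟨q, hq, hq0⟩ := exists_mem_support_neg (μ := law a b c d (0, 1)) (by
    rw [H.integral_law (by simp)]
    exact mul_neg_of_pos_of_neg (limitFactor_pos H.sigma_pos (by simp)) H.u₂_one_black_neg)
  exact eq_univ_of_splitSum_mem H.sigma_pos H.sigma_lt_one
    (fun r hr s hs v hv => hmix (H.splitSum_mem_support_law_add (by simp) (by simp) hr hs hv))
    hp hp0 (hblack hq) hq0

lemma support_law_black (H : IsLarge a b c d) : (law a b c d (0, 1)).support = Set.univ := by
  refine Set.univ_subset_iff.1 (H.support_law_red.ge.trans ?_)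
  rw [H.law_black_eq]
  exact H.support_law_mono (by simp) (by simpa using Nat.one_le_iff_ne_zero.2 H.c_ne_zero)

theorem support_law (H : IsLarge a b c d) (hx : x ≠ 0) :
    (law a b c d x).support = Set.univ := by
  refine Set.univ_subset_iff.1 ?_
  rcases Nat.eq_zero_or_pos x.1 with hred | hred
  · have hblack : x.2 ≠ 0 := fun h => hx (Prod.ext hred h)
    rw [← H.support_law_black]
    exact H.support_law_mono (by simp) ⟨zero_le, Nat.one_le_iff_ne_zero.2 hblack⟩
  · rw [← H.support_law_red]
    exact H.support_law_mono (by simp) ⟨hred, zero_le⟩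

end IsLarge

end PolyaUrn

theorem mainTheorem5_general {a b c d : ℕ} (hbalance : a + b = c + d) (hb : b ≠ 0) (hc : c ≠ 0)
    (hlarge : 1 / 2 < PolyaUrn.sigma a b c) {init : ℕ × ℕ} (hinit : init ≠ 0) {Ω : Type*}
    [MeasurableSpace Ω] {P : Measure Ω} [IsProbabilityMeasure P] {U : ℕ → Ω → ℕ × ℕ}
    (hU : PolyaUrn.IsUrnProcess a b c d init P U) :
    (∀ᵐ ω ∂P, Tendsto (fun n => PolyaUrn.normProj a b c U n ω) atTop
      (𝓝 (PolyaUrn.W a b c U ω))) ∧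
    (P.map (PolyaUrn.W a b c U)).support = Set.univ ∧
    (∀ ρ : ℝ, 0 ≤ ρ → PolyaUrn.HasCharFunDecay (P.map (PolyaUrn.W a b c U)) ρ) ∧
    PolyaUrn.HasBoundedContinuousDensity (P.map (PolyaUrn.W a b c U)) := by
  have H : PolyaUrn.IsLarge a b c d := ⟨hbalance, hb, hc, hlarge⟩
  rw [hU.map_W_eq_law H hinit]
  exact ⟨hU.ae_tendsto_normProj hbalance hlarge hinit, H.support_law hinit,
    fun _ => H.hasCharFunDecay_law hinit, H.hasBoundedContinuousDensity_law hinit⟩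

theorem mainTheorem5 (a b c d : ℕ)
    (hbalance : a + b = c + d)
    (hb : b ≠ 0) (hc : c ≠ 0)
    (hlarge : 1 / 2 < PolyaUrn.sigma a b c)
    {Ω : Type*} [MeasurableSpace Ω] (P : Measure Ω) [IsProbabilityMeasure P]
    (U : ℕ → Ω → ℕ × ℕ) (hU : PolyaUrn.IsUrnProcess a b c d (1, 0) P U)
    {Ω' : Type*} [MeasurableSpace Ω'] (P' : Measure Ω') [IsProbabilityMeasure P']
    (U' : ℕ → Ω' → ℕ × ℕ) (hU' : PolyaUrn.IsUrnProcess a b c d (0, 1) P' U') :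
    -- the almost sure limits `X` and `Y` exist
    (∀ᵐ ω ∂P, Tendsto (fun n : ℕ => PolyaUrn.normProj a b c U n ω) atTop
      (𝓝 (PolyaUrn.W a b c U ω))) ∧
    (∀ᵐ ω ∂P', Tendsto (fun n : ℕ => PolyaUrn.normProj a b c U' n ω) atTop
      (𝓝 (PolyaUrn.W a b c U' ω))) ∧
    -- (i) supports
    (P.map (PolyaUrn.W a b c U)).support = Set.univ ∧
    (P'.map (PolyaUrn.W a b c U')).support = Set.univ ∧
    -- (ii) decay of the characteristic function of `X`
    (∀ ρ : ℝ, 0 < ρ → ρ < ((a : ℝ) + 1) / PolyaUrn.eigm a c →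
      ∃ C : ℝ, 0 < C ∧ ∀ t : ℝ, t ≠ 0 →
        ‖charFun (P.map (PolyaUrn.W a b c U)) t‖ ≤ C / |t| ^ ρ) ∧
    -- (iii) decay of the characteristic function of `Y`
    (∀ ρ : ℝ, 0 < ρ → ρ < ((d : ℝ) + 1) / PolyaUrn.eigm a c →
      ∃ C : ℝ, 0 < C ∧ ∀ t : ℝ, t ≠ 0 →
        ‖charFun (P'.map (PolyaUrn.W a b c U')) t‖ ≤ C / |t| ^ ρ) ∧
    -- (iv) densities
    PolyaUrn.HasBoundedContinuousDensity (P.map (PolyaUrn.W a b c U)) ∧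
    PolyaUrn.HasBoundedContinuousDensity (P'.map (PolyaUrn.W a b c U')) := by
  obtain ⟨hlim, hsupp, hdecay, hdens⟩ :=
    mainTheorem5_general hbalance hb hc hlarge (by simp) hU
  obtain ⟨hlim', hsupp', hdecay', hdens'⟩ :=
    mainTheorem5_general hbalance hb hc hlarge (by simp) hU'
  exact ⟨hlim, hlim', hsupp, hsupp', fun ρ hρ _ => hdecay ρ hρ.le,
    fun ρ hρ _ => hdecay' ρ hρ.le, hdens, hdens'⟩
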